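/- A \emph{category with fibrations} is a category with a terminal object and a class of maps, called fibrations, such that pullbacks of fibrations along arbitrary maps exist and are fibrations. For a category with fibrations $\mathcal{C}$ and an object $X$ of $\mathcal{C}$, the local universes construction gives a contextual category $\mathcal{C}_!(X)$: a type over a context with underlying object $Y$ is a diagram $Y \xrightarrow{r} V \xleftarrow{p} E$ with $p$ a fibration, substitution is precomposition with $r$, the extended context is the chosen pullback of $p$ along $r$, contexts are finite iterated extensions starting from $X$, maps of contexts are maps of underlying objects over $X$, and terms are sections of the projections of extended contexts. Pulling back contexts along maps makes $X \mapsto \mathcal{C}_!(X)$ a strict functor from $\mathcal{C}^{\mathrm{op}}$ to contextual categories (and contextual functors). For a category with fibrations $\mathcal{B}$ let $\mathcal{B}_! = \mathcal{B}_!(1)$. For a functor $F : \mathcal{B} \to \mathcal{C}$, the contextually indexed contextual category $F^*(\mathcal{C}_!)$ over $\mathcal{B}_!$ sends a context $\Gamma$ of $\mathcal{B}_!$ to $\mathcal{C}_!(F(\Gamma))$. A map of $\mathcal{C}$ is an \emph{$F$-fibration} if it is a pullback of $F(f)$ for some fibration $f$ of $\mathcal{B}$. \textbf{Proposition.} Let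 $F : \mathcal{B} \to \mathcal{C}$ be a functor between categories with fibrations. Suppose that (1) $F$ preserves pullbacks along fibrations; (2) for every fibration $E \to V$ of $\mathcal{B}$ and every fibration $E' \to V'$ of $\mathcal{C}$ the product $F(E) \times V'$ exists in $\mathcal{C}$ (for example, $\mathcal{C}$ has binary products); (3) for every $F$-fibration $g : A \to B$, pullbacks along $g$ exist and the pullback functor $g^* : \mathcal{C}/B \to \mathcal{C}/A$ has a right adjoint $\Pi_g : \mathcal{C}/A \to \mathcal{C}/B$ which maps fibrations over $A$ to fibrations over $B$. Then $F^*(\mathcal{C}_!)$ has dependent products, that is, there are operations $$\frac{\Gamma, i : I \mid \Delta \vdash B}{\Gamma \mid \Delta \vdash \prod_{i:I} B} \qquad \frac{\Gamma, i : I \mid \Delta \vdash b : B}{\Gamma \mid \Delta \vdash \lambda i.\,b : \prod_{i:I} B} \qquad \frac{\Gamma \mid \Delta \vdash f : \prod_{i:I} B \quad \Gamma \vdash j : I}{\Gamma \mid \Delta \vdash f\,j : B[j/i]}$$ (where $i$ is not free in $\Delta$) that are stable under reindexing along maps $\Gamma' \to \Gamma$ of base contexts and under substitution along maps $\Delta'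 \to \Delta$ of indexed contexts over $\Gamma$, and that satisfy $(\lambda i.\,b)\,j = b[j/i]$ and $\lambda i.\,f\,i = f$. -/

import Mathlib

open CategoryTheory CategoryTheory.Limits Opposite

attribute [-instance] CategoryTheory.catToReflQuiver

universe u v w u' v' w' u₁ v₁ w₁ u₂ v₂ w₂

/-! ### Contextual categories -/

/-- A contextual category, presented through its types: a category of contexts, types over each
context with strictly functorial substitution, context extensions with canonical pullbacks that
are strictly functorial, a terminal empty context, and the requirement that every context is
obtained from the empty one by a finite iteration of context extensions in a unique way. -/
structure ContextualCategory where
  Ctx : Type u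
  [cat : Category.{v} Ctx]
  Ty : Ctx → Type w
  sub {Γ Δ : Ctx} (f : Δ ⟶ Γ) (A : Ty Γ) : Ty Δ
  sub_id {Γ : Ctx} (A : Ty Γ) : sub (𝟙 Γ) A = A
  sub_comp {Γ Δ Θ : Ctx} (g : Θ ⟶ Δ) (f : Δ ⟶ Γ) (A : Ty Γ) : sub (g ≫ f) A = sub g (sub f A)
  /-- The extended context `Γ, x : A`. -/
  ext (Γ : Ctx) (A : Ty Γ) : Ctx
  proj {Γ : Ctx} (A : Ty Γ) : ext Γ A ⟶ Γ
  lift {Γ Δ : Ctx} (f : Δ ⟶ Γ) (A : Ty Γ) : ext Δ (sub f A) ⟶ ext Γ A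
  isPullback {Γ Δ : Ctx} (f : Δ ⟶ Γ) (A : Ty Γ) :
    IsPullback (lift f A) (proj (sub f A)) (proj A) f
  lift_id {Γ : Ctx} (A : Ty Γ) : HEq (lift (𝟙 Γ) A) (𝟙 (ext Γ A))
  lift_comp {Γ Δ Θ : Ctx} (g : Θ ⟶ Δ) (f : Δ ⟶ Γ) (A : Ty Γ) :
    HEq (lift (g ≫ f) A) (lift g (sub f A) ≫ lift f A)
  empty : Ctx
  isTerminal : IsTerminal empty
  length : Ctx → ℕ
  length_empty : length empty = 0
  length_ext {Γ : Ctx} (A : Ty Γ) : length (ext Γ A) = length Γ + 1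
  eq_empty {Γ : Ctx} : length Γ = 0 → Γ = empty
  exists_ext {Γ : Ctx} {n : ℕ} : length Γ = n + 1 → ∃ (Δ : Ctx) (A : Ty Δ), Γ = ext Δ A
  ext_inj {Γ Δ : Ctx} {A : Ty Γ} {B : Ty Δ} : ext Γ A = ext Δ B → Γ = Δ ∧ HEq A B

attribute [instance] ContextualCategory.cat

namespace ContextualCategory

variable (K : ContextualCategory.{u, v, w})

/-- Terms of type `A`: sections of the projection `Γ, x : A ⟶ Γ`. -/
structure Tm {Γ : K.Ctx} (A : K.Ty Γ) where
  hom : Γ ⟶ K.ext Γ A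
  hom_proj : hom ≫ K.proj A = 𝟙 Γ

variable {K}

/-- Substitution into a term. -/
noncomputable def Tm.sub {Γ Δ : K.Ctx} {A : K.Ty Γ} (t : K.Tm A) (f : Δ ⟶ Γ) :
    K.Tm (K.sub f A) where
  hom := (K.isPullback f A).lift (f ≫ t.hom) (𝟙 Δ) (by simp [t.hom_proj])
  hom_proj := (K.isPullback f A).lift_snd _ _ _

theorem Tm.sub_lift {Γ Δ : K.Ctx} {A : K.Ty Γ} (t : K.Tm A) (f : Δ ⟶ Γ) :
    (t.sub f).hom ≫ K.lift f A = f ≫ t.hom :=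
  (K.isPullback f A).lift_fst _ _ _

/-- The variable `Γ, x : A ⊢ x : A`. -/
noncomputable def var {Γ : K.Ctx} (A : K.Ty Γ) : K.Tm (K.sub (K.proj A) A) where
  hom := (K.isPullback (K.proj A) A).lift (𝟙 _) (𝟙 _) (by simp)
  hom_proj := (K.isPullback (K.proj A) A).lift_snd _ _ _

theorem var_lift {Γ : K.Ctx} (A : K.Ty Γ) :
    (var A).hom ≫ K.lift (K.proj A) A = 𝟙 _ :=
  (K.isPullback (K.proj A) A).lift_fst _ _ _

/-- Transport of a type along an equality of contexts. -/
def castTy {Γ Δ : K.Ctx} (h : Γ = Δ) (A : K.Ty Γ) : K.Ty Δ := h ▸ A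

theorem castTy_heq {Γ Δ : K.Ctx} (h : Γ = Δ) (A : K.Ty Γ) : HEq (castTy h A) A := by
  subst h; rfl

/-- Transport of a term along an equality of contexts. -/
def Tm.castCtx {Γ Δ : K.Ctx} (h : Γ = Δ) {A : K.Ty Γ} (t : K.Tm A) : K.Tm (castTy h A) := by
  subst h; exact t

/-- Transport of a term along an equality of types. -/
def Tm.castTy {Γ : K.Ctx} {A B : K.Ty Γ} (h : A = B) (t : K.Tm A) : K.Tm B := h ▸ t

end ContextualCategory

open ContextualCategory

/-- A contextual functor: a functor that preserves all the structure strictly. -/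
structure ContextualFunctor (K : ContextualCategory.{u, v, w})
    (L : ContextualCategory.{u', v', w'}) extends K.Ctx ⥤ L.Ctx where
  ty {Γ : K.Ctx} (A : K.Ty Γ) : L.Ty (obj Γ)
  ty_sub {Γ Δ : K.Ctx} (f : Δ ⟶ Γ) (A : K.Ty Γ) : ty (K.sub f A) = L.sub (map f) (ty A)
  obj_ext {Γ : K.Ctx} (A : K.Ty Γ) : obj (K.ext Γ A) = L.ext (obj Γ) (ty A)
  map_proj {Γ : K.Ctx} (A : K.Ty Γ) : HEq (map (K.proj A)) (L.proj (ty A))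
  map_lift {Γ Δ : K.Ctx} (f : Δ ⟶ Γ) (A : K.Ty Γ) : HEq (map (K.lift f A)) (L.lift (map f) (ty A))
  obj_empty : obj K.empty = L.empty

namespace ContextualFunctor

theorem ext' {K : ContextualCategory.{u, v, w}} {L : ContextualCategory.{u', v', w'}}
    {Φ Ψ : ContextualFunctor K L} (hobj : ∀ Γ, Φ.obj Γ = Ψ.obj Γ)
    (hmap : ∀ (Γ Δ : K.Ctx) (f : Γ ⟶ Δ), HEq (Φ.map f) (Ψ.map f))
    (hty : ∀ (Γ : K.Ctx) (A : K.Ty Γ), HEq (Φ.ty A) (Ψ.ty A)) : Φ = Ψ := by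
  have h : Φ.toFunctor = Ψ.toFunctor := Functor.hext hobj hmap
  obtain ⟨F, ty, _, _, _, _, _⟩ := Φ
  obtain ⟨G, ty', _, _, _, _, _⟩ := Ψ
  dsimp at h
  subst h
  have : @ty = @ty' := by
    funext Γ A
    exact eq_of_heq (hty Γ A)
  subst this
  rfl

theorem map_heq {C : Type u} [Category.{v} C] {D : Type u'} [Category.{v'} D] (G : C ⥤ D)
    {X Y X' Y' : C} (hX : X = X') (hY : Y = Y') {f : X ⟶ Y} {f' : X' ⟶ Y'} (h : HEq f f') :
    HEq (G.map f) (G.map f') := by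
  subst hX hY
  cases h
  rfl

/-- The identity contextual functor. -/
def id (K : ContextualCategory.{u, v, w}) : ContextualFunctor K K where
  toFunctor := 𝟭 _
  ty A := A
  ty_sub _ _ := rfl
  obj_ext _ := rfl
  map_proj _ := HEq.rfl
  map_lift _ _ := HEq.rfl
  obj_empty := rfl

/-- Composition of contextual functors. -/
def comp {K : ContextualCategory.{u, v, w}} {L : ContextualCategory.{u', v', w'}}
    {M : ContextualCategory.{u₁, v₁, w₁}} (Φ : ContextualFunctor K L)
    (Ψ : ContextualFunctor L M) : ContextualFunctor K M where
  toFunctor := Φ.toFunctor ⋙ Ψ.toFunctor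
  ty A := Ψ.ty (Φ.ty A)
  ty_sub f A := by rw [Φ.ty_sub, Ψ.ty_sub]; rfl
  obj_ext A := by
    change Ψ.obj (Φ.obj _) = _
    rw [Φ.obj_ext, Ψ.obj_ext]; rfl
  map_proj A :=
    (map_heq Ψ.toFunctor (Φ.obj_ext A) rfl (Φ.map_proj A)).trans (Ψ.map_proj _)
  map_lift f A :=
    (map_heq Ψ.toFunctor ((Φ.obj_ext _).trans (by rw [Φ.ty_sub])) (Φ.obj_ext A)
      (Φ.map_lift f A)).trans (Ψ.map_lift _ _)
  obj_empty := by
    change Ψ.obj (Φ.obj _) = _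
    rw [Φ.obj_empty, Ψ.obj_empty]

/-- The action of a contextual functor on terms. -/
def tm {K : ContextualCategory.{u, v, w}} {L : ContextualCategory.{u', v', w'}}
    (Φ : ContextualFunctor K L) {Γ : K.Ctx} {A : K.Ty Γ} (t : K.Tm A) : L.Tm (Φ.ty A) where
  hom := Φ.map t.hom ≫ eqToHom (Φ.obj_ext A)
  hom_proj := by
    have h : eqToHom (Φ.obj_ext A) ≫ L.proj (Φ.ty A) = Φ.map (K.proj A) :=
      eq_of_heq ((eqToHom_comp_heq _ _).trans (Φ.map_proj A).symm)
    rw [Category.assoc, h, ← Φ.map_comp, t.hom_proj, Φ.map_id]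

end ContextualFunctor

/-- The category of contextual categories and contextual functors. -/
instance : Category ContextualCategory.{u, v, w} where
  Hom K L := ContextualFunctor K L
  id K := ContextualFunctor.id K
  comp Φ Ψ := ContextualFunctor.comp Φ Ψ

/-! ### Contextually indexed contextual categories and dependent products

A contextually indexed contextual category over a contextual category `𝓑` is a functor
`D : 𝓑.Ctxᵒᵖ ⥤ ContextualCategory`. -/

namespace Indexed

variable {𝓑 : ContextualCategory.{u, v, w}} (D : 𝓑.Ctxᵒᵖ ⥤ ContextualCategory.{u', v', w'})

/-- The contextual category of indexed contexts `Γ | Δ` over the base context `Γ`. -/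
abbrev fib (Γ : 𝓑.Ctx) : ContextualCategory.{u', v', w'} := D.obj (op Γ)

/-- Reindexing along a map of base contexts. -/
abbrev re {Γ Γ' : 𝓑.Ctx} (σ : Γ' ⟶ Γ) : ContextualFunctor (fib D Γ) (fib D Γ') := D.map σ.op

/-- Weakening by a base type: reindexing along `Γ, i : I ⟶ Γ`. -/
abbrev wk {Γ : 𝓑.Ctx} (I : 𝓑.Ty Γ) :
    ContextualFunctor (fib D Γ) (fib D (𝓑.ext Γ I)) := re D (𝓑.proj I)

theorem re_comp {Γ Γ' Γ'' : 𝓑.Ctx} (τ : Γ'' ⟶ Γ') (σ : Γ' ⟶ Γ) :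
    ContextualFunctor.comp (re D σ) (re D τ) = re D (τ ≫ σ) :=
  (D.map_comp σ.op τ.op).symm

theorem re_id (Γ : 𝓑.Ctx) : re D (𝟙 Γ) = ContextualFunctor.id (fib D Γ) :=
  D.map_id (op Γ)

theorem re_re_obj {Γ Γ' Γ'' : 𝓑.Ctx} (τ : Γ'' ⟶ Γ') (σ : Γ' ⟶ Γ) (Δ : (fib D Γ).Ctx) :
    (re D τ).obj ((re D σ).obj Δ) = (re D (τ ≫ σ)).obj Δ := by
  rw [← re_comp]; rfl

theorem re_re_ty {Γ Γ' Γ'' : 𝓑.Ctx} (τ : Γ'' ⟶ Γ') (σ : Γ' ⟶ Γ) {Δ : (fib D Γ).Ctx}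
    (A : (fib D Γ).Ty Δ) : HEq ((re D τ).ty ((re D σ).ty A)) ((re D (τ ≫ σ)).ty A) := by
  rw [← re_comp]; rfl

theorem re_re_map {Γ Γ' Γ'' : 𝓑.Ctx} (τ : Γ'' ⟶ Γ') (σ : Γ' ⟶ Γ) {Δ Δ' : (fib D Γ).Ctx}
    (f : Δ' ⟶ Δ) : HEq ((re D τ).map ((re D σ).map f)) ((re D (τ ≫ σ)).map f) := by
  rw [← re_comp]; rfl

theorem re_id_obj {Γ : 𝓑.Ctx} (Δ : (fib D Γ).Ctx) : (re D (𝟙 Γ)).obj Δ = Δ := by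
  rw [re_id]; rfl

theorem re_id_ty {Γ : 𝓑.Ctx} {Δ : (fib D Γ).Ctx} (A : (fib D Γ).Ty Δ) :
    HEq ((re D (𝟙 Γ)).ty A) A := by
  rw [re_id]; rfl

theorem re_id_map {Γ : 𝓑.Ctx} {Δ Δ' : (fib D Γ).Ctx} (f : Δ' ⟶ Δ) :
    HEq ((re D (𝟙 Γ)).map f) f := by
  rw [re_id]; rfl

theorem ty_heq {K : ContextualCategory.{u, v, w}} {L : ContextualCategory.{u', v', w'}}
    (Φ : ContextualFunctor K L) {Γ Δ : K.Ctx} (h : Γ = Δ) {A : K.Ty Γ} {B : K.Ty Δ}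
    (hAB : HEq A B) : HEq (Φ.ty A) (Φ.ty B) := by
  subst h; cases hAB; rfl

theorem sub_heq {K : ContextualCategory.{u, v, w}} {Γ Δ Γ' Δ' : K.Ctx} (hΓ : Γ = Γ')
    (hΔ : Δ = Δ') {f : Δ ⟶ Γ} {f' : Δ' ⟶ Γ'} (hf : HEq f f') {A : K.Ty Γ} {A' : K.Ty Γ'}
    (hA : HEq A A') : HEq (K.sub f A) (K.sub f' A') := by
  subst hΓ hΔ; cases hf; cases hA; rfl

theorem re_congr_obj {Γ Γ' : 𝓑.Ctx} {σ τ : Γ' ⟶ Γ} (h : σ = τ) (Δ : (fib D Γ).Ctx) :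
    (re D σ).obj Δ = (re D τ).obj Δ := by rw [h]

theorem re_congr_ty {Γ Γ' : 𝓑.Ctx} {σ τ : Γ' ⟶ Γ} (h : σ = τ) {Δ : (fib D Γ).Ctx}
    (A : (fib D Γ).Ty Δ) : HEq ((re D σ).ty A) ((re D τ).ty A) := by rw [h]

variable {D}

/-! Instantiation of `i : I` at a base term `Γ ⊢ j : I`. -/

theorem inst_obj {Γ : 𝓑.Ctx} {I : 𝓑.Ty Γ} (j : 𝓑.Tm I) (Δ : (fib D Γ).Ctx) :
    (re D j.hom).obj ((wk D I).obj Δ) = Δ :=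
  (re_re_obj D _ _ _).trans ((re_congr_obj D j.hom_proj Δ).trans (re_id_obj D Δ))

/-- The type `Γ | Δ ⊢ B[j/i]`. -/
def instTy {Γ : 𝓑.Ctx} {I : 𝓑.Ty Γ} (j : 𝓑.Tm I) {Δ : (fib D Γ).Ctx}
    (B : (fib D (𝓑.ext Γ I)).Ty ((wk D I).obj Δ)) : (fib D Γ).Ty Δ :=
  castTy (inst_obj j Δ) ((re D j.hom).ty B)

/-- The term `Γ | Δ ⊢ b[j/i] : B[j/i]`. -/
def instTm {Γ : 𝓑.Ctx} {I : 𝓑.Ty Γ} (j : 𝓑.Tm I) {Δ : (fib D Γ).Ctx}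
    {B : (fib D (𝓑.ext Γ I)).Ty ((wk D I).obj Δ)} (b : (fib D (𝓑.ext Γ I)).Tm B) :
    (fib D Γ).Tm (instTy j B) :=
  ((re D j.hom).tm b).castCtx (inst_obj j Δ)

/-! Reindexing of types and terms in context `Γ, i : I | Δ` along `σ : Γ' ⟶ Γ`. -/

theorem reUnder_obj {Γ Γ' : 𝓑.Ctx} (σ : Γ' ⟶ Γ) (I : 𝓑.Ty Γ) (Δ : (fib D Γ).Ctx) :
    (re D (𝓑.lift σ I)).obj ((wk D I).obj Δ) = (wk D (𝓑.sub σ I)).obj ((re D σ).obj Δ) :=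
  (re_re_obj D _ _ _).trans
    ((re_congr_obj D (𝓑.isPullback σ I).w Δ).trans (re_re_obj D _ _ _).symm)

/-- The type `Γ', i : I[σ] | Δ[σ] ⊢ B[σ, i]`. -/
def reUnderTy {Γ Γ' : 𝓑.Ctx} (σ : Γ' ⟶ Γ) {I : 𝓑.Ty Γ} {Δ : (fib D Γ).Ctx}
    (B : (fib D (𝓑.ext Γ I)).Ty ((wk D I).obj Δ)) :
    (fib D (𝓑.ext Γ' (𝓑.sub σ I))).Ty ((wk D (𝓑.sub σ I)).obj ((re D σ).obj Δ)) :=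
  castTy (reUnder_obj σ I Δ) ((re D (𝓑.lift σ I)).ty B)

/-- The term `Γ', i : I[σ] | Δ[σ] ⊢ b[σ, i] : B[σ, i]`. -/
def reUnderTm {Γ Γ' : 𝓑.Ctx} (σ : Γ' ⟶ Γ) {I : 𝓑.Ty Γ} {Δ : (fib D Γ).Ctx}
    {B : (fib D (𝓑.ext Γ I)).Ty ((wk D I).obj Δ)} (b : (fib D (𝓑.ext Γ I)).Tm B) :
    (fib D (𝓑.ext Γ' (𝓑.sub σ I))).Tm (reUnderTy σ B) :=
  ((re D (𝓑.lift σ I)).tm b).castCtx (reUnder_obj σ I Δ)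

/-- `B[σ, i][i/i] = B` for `σ` the projection `Γ, i : I ⟶ Γ`. -/
theorem instTy_var {Γ : 𝓑.Ctx} {I : 𝓑.Ty Γ} {Δ : (fib D Γ).Ctx}
    (B : (fib D (𝓑.ext Γ I)).Ty ((wk D I).obj Δ)) :
    instTy (var I) (reUnderTy (𝓑.proj I) B) = B := by
  apply eq_of_heq
  refine (castTy_heq _ _).trans ?_
  refine (ty_heq _ (reUnder_obj _ I Δ).symm (castTy_heq _ _)).trans ?_
  exact (re_re_ty D _ _ B).trans ((re_congr_ty D (var_lift I) B).trans (re_id_ty D B))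

/-- `B[j/i][σ] = B[σ, i][j[σ]/i]`. -/
theorem re_instTy {Γ Γ' : 𝓑.Ctx} (σ : Γ' ⟶ Γ) {I : 𝓑.Ty Γ} (j : 𝓑.Tm I) {Δ : (fib D Γ).Ctx}
    (B : (fib D (𝓑.ext Γ I)).Ty ((wk D I).obj Δ)) :
    (re D σ).ty (instTy j B) = instTy (j.sub σ) (reUnderTy σ B) := by
  apply eq_of_heq
  refine (ty_heq _ (inst_obj j Δ).symm (castTy_heq _ _)).trans ?_
  refine (re_re_ty D _ _ B).trans ?_
  refine HEq.trans ?_ (castTy_heq _ _).symm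
  refine HEq.trans ?_ (ty_heq _ (reUnder_obj _ I Δ).symm (castTy_heq _ _)).symm
  exact (re_congr_ty D (j.sub_lift σ).symm B).trans (re_re_ty D _ _ B).symm

/-- `B[j/i][τ] = B[τ][j/i]` for a map `τ` of indexed contexts over `Γ`. -/
theorem sub_instTy {Γ : 𝓑.Ctx} {I : 𝓑.Ty Γ} (j : 𝓑.Tm I) {Δ Δ' : (fib D Γ).Ctx} (τ : Δ' ⟶ Δ)
    (B : (fib D (𝓑.ext Γ I)).Ty ((wk D I).obj Δ)) :
    (fib D Γ).sub τ (instTy j B) =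
      instTy j ((fib D (𝓑.ext Γ I)).sub ((wk D I).map τ) B) := by
  apply eq_of_heq
  refine HEq.trans ?_ (castTy_heq _ _).symm
  rw [(re D j.hom).ty_sub]
  refine sub_heq (inst_obj j Δ).symm (inst_obj j Δ').symm ?_ (castTy_heq _ _)
  refine HEq.symm ((re_re_map D _ _ τ).trans ?_)
  rw [j.hom_proj]
  exact re_id_map D τ

variable (D)

/-- Dependent products `Γ | Δ ⊢ ∏_{i : I} B` in a contextually indexed contextual category:
formation, abstraction and application with the `β` and `η` rules, stable under reindexing along
maps `σ : Γ' ⟶ Γ` of base contexts and under substitution along maps `τ : Δ' ⟶ Δ` of indexed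
contexts. That `i` is not free in `Δ` is expressed by the weakening `wk D I` of `Δ`. -/
structure DependentProducts where
  Pi {Γ : 𝓑.Ctx} (I : 𝓑.Ty Γ) {Δ : (fib D Γ).Ctx}
    (B : (fib D (𝓑.ext Γ I)).Ty ((wk D I).obj Δ)) : (fib D Γ).Ty Δ
  lam {Γ : 𝓑.Ctx} {I : 𝓑.Ty Γ} {Δ : (fib D Γ).Ctx}
    {B : (fib D (𝓑.ext Γ I)).Ty ((wk D I).obj Δ)}
    (b : (fib D (𝓑.ext Γ I)).Tm B) : (fib D Γ).Tm (Pi I B)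
  app {Γ : 𝓑.Ctx} {I : 𝓑.Ty Γ} {Δ : (fib D Γ).Ctx}
    {B : (fib D (𝓑.ext Γ I)).Ty ((wk D I).obj Δ)}
    (f : (fib D Γ).Tm (Pi I B)) (j : 𝓑.Tm I) : (fib D Γ).Tm (instTy j B)
  Pi_re {Γ Γ' : 𝓑.Ctx} (σ : Γ' ⟶ Γ) (I : 𝓑.Ty Γ) {Δ : (fib D Γ).Ctx}
    (B : (fib D (𝓑.ext Γ I)).Ty ((wk D I).obj Δ)) :
    (re D σ).ty (Pi I B) = Pi (𝓑.sub σ I) (reUnderTy σ B)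
  lam_re {Γ Γ' : 𝓑.Ctx} (σ : Γ' ⟶ Γ) {I : 𝓑.Ty Γ} {Δ : (fib D Γ).Ctx}
    {B : (fib D (𝓑.ext Γ I)).Ty ((wk D I).obj Δ)} (b : (fib D (𝓑.ext Γ I)).Tm B) :
    ((re D σ).tm (lam b)).castTy (Pi_re σ I B) = lam (reUnderTm σ b)
  app_re {Γ Γ' : 𝓑.Ctx} (σ : Γ' ⟶ Γ) {I : 𝓑.Ty Γ} {Δ : (fib D Γ).Ctx}
    {B : (fib D (𝓑.ext Γ I)).Ty ((wk D I).obj Δ)} (f : (fib D Γ).Tm (Pi I B)) (j : 𝓑.Tm I) :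
    ((re D σ).tm (app f j)).castTy (re_instTy σ j B) =
      app (((re D σ).tm f).castTy (Pi_re σ I B)) (j.sub σ)
  Pi_sub {Γ : 𝓑.Ctx} (I : 𝓑.Ty Γ) {Δ Δ' : (fib D Γ).Ctx} (τ : Δ' ⟶ Δ)
    (B : (fib D (𝓑.ext Γ I)).Ty ((wk D I).obj Δ)) :
    (fib D Γ).sub τ (Pi I B) = Pi I ((fib D (𝓑.ext Γ I)).sub ((wk D I).map τ) B)
  lam_sub {Γ : 𝓑.Ctx} {I : 𝓑.Ty Γ} {Δ Δ' : (fib D Γ).Ctx} (τ : Δ' ⟶ Δ)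
    {B : (fib D (𝓑.ext Γ I)).Ty ((wk D I).obj Δ)} (b : (fib D (𝓑.ext Γ I)).Tm B) :
    ((lam b).sub τ).castTy (Pi_sub I τ B) = lam (b.sub ((wk D I).map τ))
  app_sub {Γ : 𝓑.Ctx} {I : 𝓑.Ty Γ} {Δ Δ' : (fib D Γ).Ctx} (τ : Δ' ⟶ Δ)
    {B : (fib D (𝓑.ext Γ I)).Ty ((wk D I).obj Δ)} (f : (fib D Γ).Tm (Pi I B)) (j : 𝓑.Tm I) :
    ((app f j).sub τ).castTy (sub_instTy j τ B) = app ((f.sub τ).castTy (Pi_sub I τ B)) j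
  /-- `(λ i. b) j = b[j/i]` -/
  beta {Γ : 𝓑.Ctx} {I : 𝓑.Ty Γ} {Δ : (fib D Γ).Ctx}
    {B : (fib D (𝓑.ext Γ I)).Ty ((wk D I).obj Δ)} (b : (fib D (𝓑.ext Γ I)).Tm B) (j : 𝓑.Tm I) :
    app (lam b) j = instTm j b
  /-- `λ i. f i = f` -/
  eta {Γ : 𝓑.Ctx} {I : 𝓑.Ty Γ} {Δ : (fib D Γ).Ctx}
    {B : (fib D (𝓑.ext Γ I)).Ty ((wk D I).obj Δ)} (f : (fib D Γ).Tm (Pi I B)) :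
    lam ((app (((wk D I).tm f).castTy (Pi_re (𝓑.proj I) I B)) (var I)).castTy
      (instTy_var B)) = f

end Indexed

/-! ### The local universes construction -/

section LocalUniverses

variable {C : Type u} [Category.{v} C]

/-- A type over `Y`: a diagram `Y ⟶ V ↞ E` whose second map is a fibration. -/
structure LocalTy (P : MorphismProperty C) (Y : C) where
  V : C
  E : C
  p : E ⟶ V
  fib : P p
  r : Y ⟶ V

namespace LocalTy

variable {P : MorphismProperty C}

/-- Substitution is precomposition. -/
abbrev sub {Y Z : C} (f : Z ⟶ Y) (A : LocalTy P Y) : LocalTy P Z where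
  V := A.V
  E := A.E
  p := A.p
  fib := A.fib
  r := f ≫ A.r

theorem sub_id {Y : C} (A : LocalTy P Y) : A.sub (𝟙 Y) = A := by
  cases A; simp

theorem sub_comp {Y Z W : C} (g : W ⟶ Z) (f : Z ⟶ Y) (A : LocalTy P Y) :
    A.sub (g ≫ f) = (A.sub f).sub g := by
  simp

variable [P.HasPullbacks]

instance {Y : C} (A : LocalTy P Y) : HasPullback A.p A.r := P.hasPullback A.r A.fib

/-- The extended context: the pullback of the diagram. -/
noncomputable def ext {Y : C} (A : LocalTy P Y) : C := pullback A.p A.r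

noncomputable def proj {Y : C} (A : LocalTy P Y) : A.ext ⟶ Y := pullback.snd A.p A.r

noncomputable def elt {Y : C} (A : LocalTy P Y) : A.ext ⟶ A.E := pullback.fst A.p A.r

theorem isPullback_elt {Y : C} (A : LocalTy P Y) : IsPullback A.elt A.proj A.p A.r :=
  IsPullback.of_hasPullback A.p A.r

noncomputable def lift {Y Z : C} (f : Z ⟶ Y) (A : LocalTy P Y) : (A.sub f).ext ⟶ A.ext :=
  A.isPullback_elt.lift (A.sub f).elt ((A.sub f).proj ≫ f) (by
    rw [Category.assoc]; exact (A.sub f).isPullback_elt.w)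

theorem lift_elt {Y Z : C} (f : Z ⟶ Y) (A : LocalTy P Y) : A.lift f ≫ A.elt = (A.sub f).elt :=
  A.isPullback_elt.lift_fst _ _ _

theorem lift_proj {Y Z : C} (f : Z ⟶ Y) (A : LocalTy P Y) :
    A.lift f ≫ A.proj = (A.sub f).proj ≫ f :=
  A.isPullback_elt.lift_snd _ _ _

theorem isPullback_lift {Y Z : C} (f : Z ⟶ Y) (A : LocalTy P Y) :
    IsPullback (A.lift f) (A.sub f).proj A.proj f := by
  refine IsPullback.of_right (h₁₂ := A.elt) (h₂₂ := A.r) (v₁₃ := A.p) ?_ (A.lift_proj f)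
    A.isPullback_elt
  rw [lift_elt]
  exact (A.sub f).isPullback_elt

theorem heq_lift {Y Z : C} (f : Z ⟶ Y) (A : LocalTy P Y) {B : LocalTy P Z} (h : A.sub f = B)
    (k : B.ext ⟶ A.ext) (h₁ : HEq (k ≫ A.elt) B.elt) (h₂ : k ≫ A.proj = B.proj ≫ f) :
    HEq (A.lift f) k := by
  subst h
  refine heq_of_eq (A.isPullback_elt.hom_ext ?_ ?_)
  · rw [lift_elt]; exact (eq_of_heq h₁).symm
  · rw [lift_proj, h₂]

theorem elt_heq {Y : C} {A B : LocalTy P Y} (h : A = B) : HEq A.elt B.elt := by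
  subst h; rfl

theorem lift_id {Y : C} (A : LocalTy P Y) : HEq (A.lift (𝟙 Y)) (𝟙 A.ext) :=
  heq_lift _ _ A.sub_id _ (by rw [Category.id_comp]) (by simp)

theorem lift_comp {Y Z W : C} (g : W ⟶ Z) (f : Z ⟶ Y) (A : LocalTy P Y) :
    HEq (A.lift (g ≫ f)) ((A.sub f).lift g ≫ A.lift f) := by
  refine heq_lift _ _ (A.sub_comp g f) _ ?_ ?_
  · refine heq_of_eq ((Category.assoc _ _ _).trans ?_)
    rw [lift_elt]
    exact (A.sub f).lift_elt g
  · rw [Category.assoc, lift_proj, ← Category.assoc, lift_proj, Category.assoc]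

theorem exists_lift_heq {W Y Y' Z : C} (A : LocalTy P W) {a : Z ⟶ Y} {b : Y ⟶ W} {a' : Z ⟶ Y'}
    {b' : Y' ⟶ W} (w : a ≫ b = a' ≫ b') (e : (A.sub b).sub a = (A.sub b').sub a') :
    ∃ m : ((A.sub b').sub a').ext ⟶ (A.sub b).ext,
      HEq ((A.sub b).lift a) m ∧ (A.sub b').lift a' ≫ A.lift b' = m ≫ A.lift b := by
  have hw : ((A.sub b').sub a').elt ≫ (A.sub b).p =
      (((A.sub b').sub a').proj ≫ a) ≫ (A.sub b).r := by
    refine ((A.sub b').sub a').isPullback_elt.w.trans ?_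
    change _ ≫ a' ≫ b' ≫ A.r = (_ ≫ a) ≫ b ≫ A.r
    rw [Category.assoc, ← Category.assoc a' b', ← w, Category.assoc]
  refine ⟨(A.sub b).isPullback_elt.lift ((A.sub b').sub a').elt (((A.sub b').sub a').proj ≫ a) hw,
    heq_lift _ _ e _ (heq_of_eq ((A.sub b).isPullback_elt.lift_fst _ _ _))
      ((A.sub b).isPullback_elt.lift_snd _ _ _), A.isPullback_elt.hom_ext ?_ ?_⟩
  · rw [Category.assoc, Category.assoc, lift_elt, lift_elt, lift_elt]
    exact ((A.sub b).isPullback_elt.lift_fst _ _ _).symm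
  · rw [Category.assoc, Category.assoc, lift_proj, lift_proj, ← Category.assoc, lift_proj,
      ← Category.assoc, (A.sub b).isPullback_elt.lift_snd, Category.assoc, Category.assoc, w]

end LocalTy

variable (P : MorphismProperty C) [P.HasPullbacks]

/-- `Tele P X Y`: iterated context extensions of `X` with resulting object `Y`. -/
inductive Tele (X : C) : C → Type max u v
  | nil : Tele X X
  | snoc {Y : C} (Δ : Tele X Y) (A : LocalTy P Y) : Tele X A.ext

/-- A context over `X`: an object with the iterated context extension that it comes from. -/
structure LocalCtx (X : C) where
  obj : C
  tele : Tele P X obj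

variable {P}

namespace Tele

noncomputable def proj {X : C} : {Y : C} → Tele P X Y → (Y ⟶ X)
  | _, nil => 𝟙 X
  | _, snoc Δ A => A.proj ≫ Δ.proj

def length {X : C} : {Y : C} → Tele P X Y → ℕ
  | _, nil => 0
  | _, snoc Δ _ => Δ.length + 1

/-- The last type of a non-empty context. -/
noncomputable def last {X : C} : {Y : C} → Tele P X Y → Option (Σ Δ : LocalCtx P X, LocalTy P Δ.obj)
  | _, nil => none
  | _, snoc Δ A => some ⟨⟨_, Δ⟩, A⟩

/-- Reindexing of a context along `f : X' ⟶ X`, with the comparison map of its object. -/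
noncomputable def reindex {X X' : C} (f : X' ⟶ X) :
    {Y : C} → Tele P X Y → Σ Δ' : LocalCtx P X', Δ'.obj ⟶ Y
  | _, nil => ⟨⟨X', nil⟩, f⟩
  | _, snoc Δ A =>
    ⟨⟨(A.sub (Δ.reindex f).2).ext, snoc (Δ.reindex f).1.tele (A.sub (Δ.reindex f).2)⟩,
      A.lift (Δ.reindex f).2⟩

theorem isPullback_reindex {X X' : C} (f : X' ⟶ X) {Y : C} (Δ : Tele P X Y) :
    IsPullback (Δ.reindex f).2 (Δ.reindex f).1.tele.proj Δ.proj f := by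
  induction Δ with
  | nil => exact IsPullback.id_vert f
  | snoc Δ A ih => exact (A.isPullback_lift _).paste_vert ih

theorem snoc_ext {X : C} {Y Y' W : C} {T : Tele P X Y} {T' : Tele P X Y'}
    {h : Y ⟶ W} {h' : Y' ⟶ W} (A : LocalTy P W)
    (e : (⟨⟨Y, T⟩, h⟩ : Σ Δ' : LocalCtx P X, Δ'.obj ⟶ W) = ⟨⟨Y', T'⟩, h'⟩) :
    (⟨⟨_, snoc T (A.sub h)⟩, A.lift h⟩ : Σ Δ' : LocalCtx P X, Δ'.obj ⟶ A.ext) =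
      ⟨⟨_, snoc T' (A.sub h')⟩, A.lift h'⟩ := by
  cases e; rfl

theorem snoc_ext' {X Y W : C} (T : Tele P X Y) {A : LocalTy P W} {B B' : LocalTy P Y}
    (e : B = B') {k : B.ext ⟶ A.ext} {k' : B'.ext ⟶ A.ext} (hk : HEq k k') :
    (⟨⟨_, snoc T B⟩, k⟩ : Σ Δ' : LocalCtx P X, Δ'.obj ⟶ A.ext) = ⟨⟨_, snoc T B'⟩, k'⟩ := by
  subst e; cases hk; rfl

theorem reindex_id {X Y : C} (Δ : Tele P X Y) : Δ.reindex (𝟙 X) = ⟨⟨Y, Δ⟩, 𝟙 Y⟩ := by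
  induction Δ with
  | nil => rfl
  | snoc Δ A ih => exact (snoc_ext A ih).trans (snoc_ext' Δ A.sub_id A.lift_id)

theorem reindex_comp {X X' X'' : C} (g : X'' ⟶ X') (f : X' ⟶ X) {Y : C} (Δ : Tele P X Y) :
    Δ.reindex (g ≫ f) = ⟨((Δ.reindex f).1.tele.reindex g).1,
      ((Δ.reindex f).1.tele.reindex g).2 ≫ (Δ.reindex f).2⟩ := by
  induction Δ with
  | nil => rfl
  | snoc Δ A ih => exact (snoc_ext A ih).trans (snoc_ext' _ (A.sub_comp _ _) (A.lift_comp _ _))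

end Tele

namespace LocalCtx

/-- Maps of contexts over `X`: maps of their objects over `X`. -/
@[ext]
structure Hom {X : C} (Δ Δ' : LocalCtx P X) where
  hom : Δ.obj ⟶ Δ'.obj
  w : hom ≫ Δ'.tele.proj = Δ.tele.proj

@[simps]
noncomputable instance (X : C) : Category (LocalCtx P X) where
  Hom := Hom
  id Δ := ⟨𝟙 _, Category.id_comp _⟩
  comp f g := ⟨f.hom ≫ g.hom, by rw [Category.assoc, g.w, f.w]⟩
  id_comp f := Hom.ext (Category.id_comp _)
  comp_id f := Hom.ext (Category.comp_id _)
  assoc f g h := Hom.ext (Category.assoc _ _ _)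

@[ext]
theorem hom_ext {X : C} {Δ Δ' : LocalCtx P X} {f g : Δ ⟶ Δ'} (h : f.hom = g.hom) : f = g :=
  Hom.ext h

/-- The object of a context. -/
@[simps]
noncomputable def forget (P : MorphismProperty C) [P.HasPullbacks] (X : C) :
    LocalCtx P X ⥤ C where
  obj Δ := Δ.obj
  map f := f.hom

theorem hom_heq {X : C} {Δ₁ Δ₁' Δ₂ Δ₂' : LocalCtx P X} (h : Δ₁ = Δ₂) (h' : Δ₁' = Δ₂')
    {f : Δ₁ ⟶ Δ₁'} {g : Δ₂ ⟶ Δ₂'} (e : HEq f.hom g.hom) : HEq f g := by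
  subst h h'
  exact heq_of_eq (hom_ext (eq_of_heq e))

noncomputable def ext {X : C} (Δ : LocalCtx P X) (A : LocalTy P Δ.obj) : LocalCtx P X :=
  ⟨A.ext, .snoc Δ.tele A⟩

noncomputable def reindex {X X' : C} (f : X' ⟶ X) (Δ : LocalCtx P X) : LocalCtx P X' :=
  (Δ.tele.reindex f).1

noncomputable def reindexMap {X X' : C} (f : X' ⟶ X) (Δ : LocalCtx P X) :
    (Δ.reindex f).obj ⟶ Δ.obj :=
  (Δ.tele.reindex f).2

theorem isPullback_reindex {X X' : C} (f : X' ⟶ X) (Δ : LocalCtx P X) :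
    IsPullback (Δ.reindexMap f) (Δ.reindex f).tele.proj Δ.tele.proj f :=
  Δ.tele.isPullback_reindex f

/-- The projection of an extended context. -/
noncomputable def projHom {X : C} {Γ : LocalCtx P X} (A : LocalTy P Γ.obj) : Γ.ext A ⟶ Γ :=
  Hom.mk A.proj rfl

noncomputable def liftHom {X : C} {Γ Δ : LocalCtx P X} (f : Δ ⟶ Γ) (A : LocalTy P Γ.obj) :
    Δ.ext (A.sub f.hom) ⟶ Γ.ext A :=
  Hom.mk (A.lift f.hom) (by
    change A.lift f.hom ≫ A.proj ≫ Γ.tele.proj = (A.sub f.hom).proj ≫ Δ.tele.proj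
    rw [← f.w, ← Category.assoc, A.lift_proj, Category.assoc])

theorem isPullback_liftHom {X : C} {Γ Δ : LocalCtx P X} (f : Δ ⟶ Γ) (A : LocalTy P Γ.obj) :
    IsPullback (liftHom f A) (projHom (A.sub f.hom)) (projHom A) f := by
  have h := A.isPullback_lift f.hom
  refine ⟨⟨hom_ext h.w⟩, ⟨PullbackCone.IsLimit.mk _
    (fun s => Hom.mk (h.lift s.fst.hom s.snd.hom (congrArg Hom.hom s.condition)) ?_)
    (fun s => hom_ext (h.lift_fst _ _ _))
    (fun s => hom_ext (h.lift_snd _ _ _))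
    (fun s m h₁ h₂ => hom_ext (h.hom_ext ?_ ?_))⟩⟩
  · change _ ≫ (A.sub f.hom).proj ≫ Δ.tele.proj = _
    exact (Category.assoc _ _ _).symm.trans
      ((congrArg (fun k => k ≫ Δ.tele.proj) (h.lift_snd _ _ _)).trans s.snd.w)
  · exact (congrArg Hom.hom h₁).trans (h.lift_fst _ _ _).symm
  · exact (congrArg Hom.hom h₂).trans (h.lift_snd _ _ _).symm

/-- Reindexing of a map of contexts: the map induced on the pullbacks. -/
noncomputable def reindexHom {X X' : C} (f : X' ⟶ X) {Δ Δ' : LocalCtx P X} (h : Δ ⟶ Δ') :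
    Δ.reindex f ⟶ Δ'.reindex f :=
  Hom.mk ((Δ'.isPullback_reindex f).lift (Δ.reindexMap f ≫ h.hom) (Δ.reindex f).tele.proj (by
      rw [Category.assoc, h.w, (Δ.isPullback_reindex f).w]))
    ((Δ'.isPullback_reindex f).lift_snd _ _ _)

theorem reindexHom_map {X X' : C} (f : X' ⟶ X) {Δ Δ' : LocalCtx P X} (h : Δ ⟶ Δ') :
    (reindexHom f h).hom ≫ Δ'.reindexMap f = Δ.reindexMap f ≫ h.hom :=
  (Δ'.isPullback_reindex f).lift_fst _ _ _

theorem reindexHom_unique {X X' : C} (f : X' ⟶ X) {Δ Δ' : LocalCtx P X} {h : Δ ⟶ Δ'}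
    {k : Δ.reindex f ⟶ Δ'.reindex f}
    (e : k.hom ≫ Δ'.reindexMap f = Δ.reindexMap f ≫ h.hom) : reindexHom f h = k :=
  hom_ext ((Δ'.isPullback_reindex f).hom_ext ((reindexHom_map f h).trans e.symm)
    ((reindexHom f h).w.trans k.w.symm))

theorem reindexHom_heq {X X' : C} (f : X' ⟶ X) {Δ Δ' : LocalCtx P X} (h : Δ ⟶ Δ')
    {Θ Θ' : LocalCtx P X'} {k : Θ ⟶ Θ'} {m : Θ.obj ⟶ Δ.obj} {m' : Θ'.obj ⟶ Δ'.obj}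
    (e : Δ.tele.reindex f = ⟨Θ, m⟩) (e' : Δ'.tele.reindex f = ⟨Θ', m'⟩)
    (w : k.hom ≫ m' = m ≫ h.hom) : HEq (reindexHom f h) k := by
  have hΘ : Δ.reindex f = Θ := congrArg Sigma.fst e
  have hΘ' : Δ'.reindex f = Θ' := congrArg Sigma.fst e'
  subst hΘ hΘ'
  have hm : Δ.reindexMap f = m := eq_of_heq (Sigma.mk.inj e).2
  have hm' : Δ'.reindexMap f = m' := eq_of_heq (Sigma.mk.inj e').2
  subst hm hm'
  exact heq_of_eq (reindexHom_unique f w)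

theorem sub_heq {X : C} {Θ Θ' : LocalCtx P X} {Y : C} {m : Θ.obj ⟶ Y} {m' : Θ'.obj ⟶ Y}
    (e : (⟨Θ, m⟩ : Σ Δ' : LocalCtx P X, Δ'.obj ⟶ Y) = ⟨Θ', m'⟩) (A : LocalTy P Y) :
    HEq (A.sub m) (A.sub m') := by
  cases e; rfl

end LocalCtx

variable (P)

/-- The contextual category of contexts over `X` given by local universes. For `X` a terminal
object this is the contextual category `C_!`; in general it is its indexed version over `X`. -/
noncomputable def localUniverses (X : C) : ContextualCategory.{max u v, v, max u v} where
  Ctx := LocalCtx P X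
  cat := inferInstance
  Ty Δ := LocalTy P Δ.obj
  sub f A := A.sub (LocalCtx.Hom.hom f)
  sub_id A := A.sub_id
  sub_comp g f A := A.sub_comp (LocalCtx.Hom.hom g) (LocalCtx.Hom.hom f)
  ext Δ A := Δ.ext A
  proj A := LocalCtx.projHom A
  lift f A := LocalCtx.liftHom f A
  isPullback f A := LocalCtx.isPullback_liftHom f A
  lift_id {Γ} A := LocalCtx.hom_heq (congrArg Γ.ext A.sub_id) rfl A.lift_id
  lift_comp {_ _ Θ} g f A :=
    LocalCtx.hom_heq (congrArg Θ.ext (A.sub_comp (LocalCtx.Hom.hom g) (LocalCtx.Hom.hom f))) rfl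
      (A.lift_comp (LocalCtx.Hom.hom g) (LocalCtx.Hom.hom f))
  empty := ⟨X, .nil⟩
  isTerminal := IsTerminal.ofUniqueHom
    (fun Δ => LocalCtx.Hom.mk Δ.tele.proj (Category.comp_id _))
    (fun _ m => LocalCtx.hom_ext ((Category.comp_id _).symm.trans (LocalCtx.Hom.w m)))
  length Δ := Δ.tele.length
  length_empty := rfl
  length_ext _ := rfl
  eq_empty {Γ} h := by
    obtain ⟨Y, T⟩ := Γ
    cases T with
    | nil => rfl
    | snoc T A => exact absurd h (Nat.succ_ne_zero _)
  exists_ext {Γ} n h := by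
    obtain ⟨Y, T⟩ := Γ
    cases T with
    | nil => exact absurd h (Nat.succ_ne_zero _).symm
    | snoc T A => exact ⟨⟨_, T⟩, A, rfl⟩
  ext_inj {Γ Δ A B} h := by
    have e : (some ⟨Γ, A⟩ : Option (Σ Δ : LocalCtx P X, LocalTy P Δ.obj)) = some ⟨Δ, B⟩ :=
      congrArg (fun Θ : LocalCtx P X => Θ.tele.last) h
    cases e
    exact ⟨rfl, HEq.rfl⟩

/-- Reindexing of contexts, types and maps along `f : X' ⟶ X`. -/
noncomputable def localUniversesReindex {X X' : C} (f : X' ⟶ X) :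
    ContextualFunctor (localUniverses P X) (localUniverses P X') where
  obj (Δ : LocalCtx P X) := Δ.reindex f
  map {Δ Δ' : LocalCtx P X} (h : Δ ⟶ Δ') := LocalCtx.reindexHom f h
  map_id (Δ : LocalCtx P X) := LocalCtx.reindexHom_unique f
    ((Category.id_comp _).trans (Category.comp_id _).symm)
  map_comp {Δ Δ' Δ'' : LocalCtx P X} (h : Δ ⟶ Δ') (h' : Δ' ⟶ Δ'') :=
    LocalCtx.reindexHom_unique f (by
      change ((LocalCtx.reindexHom f h).hom ≫ (LocalCtx.reindexHom f h').hom) ≫ _ =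
        _ ≫ h.hom ≫ h'.hom
      rw [Category.assoc, LocalCtx.reindexHom_map, ← Category.assoc, LocalCtx.reindexHom_map,
        Category.assoc])
  ty {Δ : LocalCtx P X} (A : LocalTy P Δ.obj) := A.sub (Δ.reindexMap f)
  ty_sub {Γ Δ : LocalCtx P X} (h : Δ ⟶ Γ) (A : LocalTy P Γ.obj) :=
    (A.sub_comp _ _).symm.trans
      ((congrArg (fun k => A.sub k) (LocalCtx.reindexHom_map f h).symm).trans (A.sub_comp _ _))
  obj_ext _ := rfl
  map_proj {Γ : LocalCtx P X} (A : LocalTy P Γ.obj) := heq_of_eq <|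
    LocalCtx.reindexHom_unique f (A.lift_proj _).symm
  map_lift {Γ Δ : LocalCtx P X} (h : Δ ⟶ Γ) (A : LocalTy P Γ.obj) := by
    have e : (A.sub h.hom).sub (Δ.reindexMap f) =
        (A.sub (Γ.reindexMap f)).sub (LocalCtx.reindexHom f h).hom :=
      (A.sub_comp _ _).symm.trans
        ((congrArg (fun k => A.sub k) (LocalCtx.reindexHom_map f h).symm).trans (A.sub_comp _ _))
    obtain ⟨m, hm, hm'⟩ := A.exists_lift_heq (LocalCtx.reindexHom_map f h).symm e
    exact LocalCtx.reindexHom_heq f (LocalCtx.liftHom h A)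
      (k := LocalCtx.liftHom (LocalCtx.reindexHom f h) (A.sub (Γ.reindexMap f)))
      (Tele.snoc_ext' (Δ.reindex f).tele e hm) rfl hm'
  obj_empty := rfl

/-- The local universes construction as a functor `Cᵒᵖ ⥤ ContextualCategory`. -/
noncomputable def localUniversesFunctor : Cᵒᵖ ⥤ ContextualCategory.{max u v, v, max u v} where
  obj X := localUniverses P X.unop
  map f := localUniversesReindex P f.unop
  map_id X := ContextualFunctor.ext'
    (fun (Δ : LocalCtx P X.unop) => congrArg Sigma.fst Δ.tele.reindex_id)
    (fun (Δ Δ' : LocalCtx P X.unop) (h : Δ ⟶ Δ') =>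
      LocalCtx.reindexHom_heq (𝟙 _) h Δ.tele.reindex_id Δ'.tele.reindex_id
        ((Category.comp_id _).trans (Category.id_comp _).symm))
    (fun (Δ : LocalCtx P X.unop) (A : LocalTy P Δ.obj) =>
      (LocalCtx.sub_heq Δ.tele.reindex_id A).trans (heq_of_eq A.sub_id))
  map_comp {X Y Z} f g := ContextualFunctor.ext'
    (fun (Δ : LocalCtx P X.unop) => congrArg Sigma.fst (Δ.tele.reindex_comp g.unop f.unop))
    (fun (Δ Δ' : LocalCtx P X.unop) (h : Δ ⟶ Δ') =>
      LocalCtx.reindexHom_heq (g.unop ≫ f.unop) h (Δ.tele.reindex_comp _ _)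
        (Δ'.tele.reindex_comp _ _)
        (k := LocalCtx.reindexHom g.unop (LocalCtx.reindexHom f.unop h)) (by
          have h₁ := LocalCtx.reindexHom_map g.unop (LocalCtx.reindexHom f.unop h)
          have h₂ := LocalCtx.reindexHom_map f.unop h
          refine (Category.assoc _ _ _).symm.trans ((congrArg (· ≫ _) h₁).trans ?_)
          refine (Category.assoc _ _ _).trans ((congrArg (_ ≫ ·) h₂).trans ?_)
          exact (Category.assoc _ _ _).symm))
    (fun (Δ : LocalCtx P X.unop) (A : LocalTy P Δ.obj) =>
      (LocalCtx.sub_heq (Δ.tele.reindex_comp g.unop f.unop) A).trans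
        (heq_of_eq (A.sub_comp _ _)))

end LocalUniverses

/-! ### Change of base -/

section ChangeOfBase

variable {B : Type u₁} [Category.{v₁} B] {C : Type u₂} [Category.{v₂} C]

/-- The contextual category `B_!` of a category with fibrations `(B, P)`. -/
noncomputable abbrev localUniversesTop (P : MorphismProperty B) [P.HasPullbacks]
    [HasTerminal B] : ContextualCategory.{max u₁ v₁, v₁, max u₁ v₁} :=
  localUniverses P (⊤_ B)

/-- The functor `Γ ↦ F(Γ)` from contexts of `B_!` to `C` induced by a functor `F : B ⥤ C`. -/
noncomputable def contextFunctor (PB : MorphismProperty B) [PB.HasPullbacks] [HasTerminal B]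
    (F : B ⥤ C) : (localUniversesTop PB).Ctx ⥤ C :=
  LocalCtx.forget PB (⊤_ B) ⋙ F

/-- The contextually indexed contextual category `F^*(C_!)` over `B_!`: its closed indexed types
over a context `Γ` of `B_!` are diagrams `F(Γ) ⟶ V ↞ E`. -/
noncomputable def changeOfBase (PB : MorphismProperty B) [PB.HasPullbacks] [HasTerminal B]
    (PC : MorphismProperty C) [PC.HasPullbacks] (F : B ⥤ C) :
    (localUniversesTop PB).Ctxᵒᵖ ⥤ ContextualCategory.{max u₂ v₂, v₂, max u₂ v₂} :=
  (contextFunctor PB F).op ⋙ localUniversesFunctor PC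

/-- The `F`-fibrations: pullbacks of maps `F(f)` for fibrations `f`. -/
def IsFFibration (PB : MorphismProperty B) (F : B ⥤ C) {X Y : C} (g : X ⟶ Y) : Prop :=
  ∃ (E V : B) (f : E ⟶ V), PB f ∧
    ∃ (k : X ⟶ F.obj E) (h : Y ⟶ F.obj V), IsPullback k g (F.map f) h

/-- Pullbacks of `g` exist and the pullback functor `g^* : C/Y ⥤ C/X` has a right adjoint that maps
fibrations over `X` to fibrations over `Y`. -/
def HasFibrantPushforward (PC : MorphismProperty C) {X Y : C} (g : X ⟶ Y) : Prop :=
  ∃ (_ : HasPullbacksAlong g) (Pi : Over X ⥤ Over Y) (_ : Over.pullback g ⊣ Pi),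
    ∀ Z : Over X, PC Z.hom → PC (Pi.obj Z).hom

end ChangeOfBase

/-! In local universes a dependent product has to be formed only once, over a generic context. Let
`I` be `Γ ⟶ V ↞ E` with fibration `p`, and let a type over the weakening of `Δ` by `I` be classified
by a map into `V'` with fibration `p' : E' ⟶ V'`. Since `F` preserves the pullback that defines `Γ,
i : I`, pasting shows that the weakened context is the pullback of `F(p)` along `Δ ⟶ F(Γ) ⟶ F(V)`
(`isPullback_paste`). Hence maps from it to `V'` correspond to maps `Δ ⟶ W` over `F(V)`, where `W`
is the exponential of `V'` along `F(p)`, that is, the pushforward of `F(E) × V' ⟶ F(E)`. Maps to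
`E'` correspond in the same way to maps into an exponential `U` of `E'`, and composition with `p'`
induces `π : U ⟶ W`. The product type is `Δ ⟶ W ↞ U`.

For this `π` must be a fibration. The evaluation map `W ×_{F(V)} F(E) ⟶ V'` pulls `p'` back to a
fibration, and `π` is the pushforward of that fibration along the projection to `W`. The projection
is a pullback of `F(p)`, hence an `F`-fibration, so the pushforward is again a fibration
(`nonempty_piUniverse`).

The map `π` depends only on `p` and `p'`, which substitution never changes. Strict stability
therefore reduces to naturality of transposition (`comp_curry`, `comp_uncurry`) and to identities
between maps of weakened contexts. The β and η rules say that transposition is a bijection. Terms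
are handled as elements `Δ ⟶ E` lifting the classifying map (`elem`), which turns equations between
terms into equations between maps of `C`. -/

/-! ### Pushforwards and exponentials along a map -/

section Pushforward

variable {C : Type u} [Category.{v} C]

/-- A pushforward of `z : Z ⟶ A` along `q : A ⟶ D`: an object `w : W ⟶ D` over `D` with an
evaluation map `W ×_D A ⟶ Z` over `A`, universal among maps `Y ×_D A ⟶ Z` over `A`. -/
structure PushforwardObj {A D Z : C} (q : A ⟶ D) (z : Z ⟶ A) where
  W : C
  w : W ⟶ D
  R : C
  fst : R ⟶ A
  snd : R ⟶ W
  isPullback : IsPullback fst snd q w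
  ev : R ⟶ Z
  ev_comp : ev ≫ z = fst
  existsUnique {Y P : C} {k : P ⟶ A} {g : P ⟶ Y} {y : Y ⟶ D} (sq : IsPullback k g q y)
    (b : P ⟶ Z) : b ≫ z = k →
      ∃! c : Y ⟶ W, c ≫ w = y ∧ ∃ m : P ⟶ R, m ≫ fst = k ∧ m ≫ snd = g ≫ c ∧ m ≫ ev = b

/-- The pushforward of an object given by a right adjoint of the pullback functor. -/
noncomputable def PushforwardObj.ofAdjunction {A D Z : C} (q : A ⟶ D) [HasPullbacksAlong q]
    {Pi : Over A ⥤ Over D} (adj : Over.pullback q ⊣ Pi) (z : Z ⟶ A) : PushforwardObj q z where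
  W := (Pi.obj (Over.mk z)).left
  w := (Pi.obj (Over.mk z)).hom
  R := pullback (Pi.obj (Over.mk z)).hom q
  fst := pullback.snd _ _
  snd := pullback.fst _ _
  isPullback := (IsPullback.of_hasPullback _ _).flip
  ev := (adj.counit.app (Over.mk z)).left
  ev_comp := Over.w (adj.counit.app (Over.mk z))
  existsUnique {Y P k g y} sq b hb := by
    -- The universal property is required for every pullback square, since weakened contexts are not
    -- the chosen pullbacks; `i` carries the adjunction over to `P`.
    let i : P ≅ pullback y q := sq.flip.isoPullback
    have hi₁ : i.hom ≫ pullback.fst y q = g := sq.flip.isoPullback_hom_fst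
    have hi₂ : i.hom ≫ pullback.snd y q = k := sq.flip.isoPullback_hom_snd
    let β : (Over.pullback q).obj (Over.mk y) ⟶ Over.mk z := Over.homMk (i.inv ≫ b) (by
      change (i.inv ≫ b) ≫ z = pullback.snd y q
      rw [Category.assoc, hb, ← hi₂, Iso.inv_hom_id_assoc])
    have map_fst (c : Over.mk y ⟶ Pi.obj (Over.mk z)) :
        i.hom ≫ ((Over.pullback q).map c).left ≫ pullback.fst (Pi.obj (Over.mk z)).hom q =
          g ≫ c.left := by
      have h : ((Over.pullback q).map c).left ≫ pullback.fst (Pi.obj (Over.mk z)).hom q =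
          pullback.fst y q ≫ c.left := pullback.lift_fst _ _ _
      rw [h, ← hi₁, Category.assoc]
    have map_snd (c : Over.mk y ⟶ Pi.obj (Over.mk z)) :
        i.hom ≫ ((Over.pullback q).map c).left ≫ pullback.snd (Pi.obj (Over.mk z)).hom q = k := by
      have h : ((Over.pullback q).map c).left ≫ pullback.snd (Pi.obj (Over.mk z)).hom q =
          pullback.snd y q := pullback.lift_snd _ _ _
      rw [h, hi₂]
    -- The counit after the pullback of the transpose of `β` is `β` itself.
    have hc := (adj.homEquiv (Over.mk y) (Over.mk z)).symm_apply_apply β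
    rw [Adjunction.homEquiv_counit] at hc
    refine ⟨((adj.homEquiv _ _) β).left, ⟨Over.w ((adj.homEquiv _ _) β),
      i.hom ≫ ((Over.pullback q).map ((adj.homEquiv _ _) β)).left, ?_, ?_, ?_⟩, ?_⟩
    · exact (Category.assoc _ _ _).trans (map_snd _)
    · exact (Category.assoc _ _ _).trans (map_fst _)
    · rw [Category.assoc, ← Over.comp_left, hc]
      exact i.hom_inv_id_assoc b
    · rintro c ⟨hc₁, m, hm₁, hm₂, hm₃⟩
      let γ : Over.mk y ⟶ Pi.obj (Over.mk z) := Over.homMk c hc₁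
      change γ.left = _
      congr 1
      apply (adj.homEquiv _ _).symm.injective
      rw [Equiv.symm_apply_apply, Adjunction.homEquiv_counit]
      apply Over.OverMorphism.ext
      rw [Over.comp_left]
      change _ = i.inv ≫ b
      -- A mediating map is determined by its two projections, so `m` must be the pullback of `c`;
      -- injectivity of transposition then fixes `c`.
      have hm : m = i.hom ≫ ((Over.pullback q).map γ).left :=
        pullback.hom_ext (hm₂.trans ((Category.assoc _ _ _).trans (map_fst γ)).symm)
          (hm₁.trans ((Category.assoc _ _ _).trans (map_snd γ)).symm)
      rw [← hm₃, hm, Category.assoc, i.inv_hom_id_assoc]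

/-- An exponential of `Z` along `q : A ⟶ D`: an object `w : W ⟶ D` over `D` such that maps
`Y ⟶ W` over `D` are maps `Y ×_D A ⟶ Z`. -/
structure Exponential {A D : C} (q : A ⟶ D) (Z : C) where
  W : C
  w : W ⟶ D
  R : C
  fst : R ⟶ A
  snd : R ⟶ W
  isPullback : IsPullback fst snd q w
  ev : R ⟶ Z
  existsUnique {Y P : C} {k : P ⟶ A} {g : P ⟶ Y} {y : Y ⟶ D} (sq : IsPullback k g q y)
    (b : P ⟶ Z) :
      ∃! c : Y ⟶ W, c ≫ w = y ∧ ∃ m : P ⟶ R, m ≫ fst = k ∧ m ≫ snd = g ≫ c ∧ m ≫ ev = b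

/-- The exponential as the pushforward of a product projection. -/
noncomputable def PushforwardObj.exponential {A D Z : C} {q : A ⟶ D} [HasBinaryProduct A Z]
    (T : PushforwardObj q (prod.fst : A ⨯ Z ⟶ A)) : Exponential q Z where
  W := T.W
  w := T.w
  R := T.R
  fst := T.fst
  snd := T.snd
  isPullback := T.isPullback
  ev := T.ev ≫ prod.snd
  existsUnique {Y P k g y} sq b := by
    obtain ⟨c, ⟨hc, m, hm₁, hm₂, hm₃⟩, hu⟩ :=
      T.existsUnique sq (prod.lift k b) (prod.lift_fst _ _)
    refine ⟨c, ⟨hc, m, hm₁, hm₂, ?_⟩, ?_⟩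
    · rw [← Category.assoc, hm₃, prod.lift_snd]
    · rintro c' ⟨hc', m', hm₁', hm₂', hm₃'⟩
      refine hu c' ⟨hc', m', hm₁', hm₂', ?_⟩
      apply prod.hom_ext
      · rw [Category.assoc, T.ev_comp, hm₁', prod.lift_fst]
      · rw [Category.assoc, hm₃', prod.lift_snd]

/-- Given an exponential of `V` along `q` and a map `p : E ⟶ V`, the pushforward of the pullback of
`p` along the evaluation map is an exponential of `E` along `q`. -/
noncomputable def Exponential.ofPushforward {A D E V E' : C} {q : A ⟶ D} {p : E ⟶ V}
    (X : Exponential q V) {s : E' ⟶ E} {e : E' ⟶ X.R} (h : IsPullback s e p X.ev)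
    (T : PushforwardObj X.snd e) : Exponential q E where
  W := T.W
  w := T.w ≫ X.w
  R := T.R
  fst := T.fst ≫ X.fst
  snd := T.snd
  isPullback := (T.isPullback.flip.paste_vert X.isPullback.flip).flip
  ev := T.ev ≫ s
  existsUnique {Y P k g y} sq b := by
    obtain ⟨c, ⟨hc, m, hm₁, hm₂, hm₃⟩, hu⟩ := X.existsUnique sq (b ≫ p)
    -- Cancelling the square of `X` from `sq` exhibits `P` as the pullback of `c` along `X.snd`, so
    -- the universal property of `T` applies over `c`.
    have sq' : IsPullback m g X.snd c := by
      subst hc hm₁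
      exact (IsPullback.of_bot sq.flip hm₂.symm X.isPullback.flip).flip
    -- The map `b` and the map `m` into `X.R` agree in `V`, so together they form a map into the
    -- pullback `E'`.
    obtain ⟨d, ⟨hd, n, hn₁, hn₂, hn₃⟩, hu'⟩ :=
      T.existsUnique sq' (h.lift b m hm₃.symm) (h.lift_snd _ _ _)
    refine ⟨d, ⟨by rw [← Category.assoc, hd, hc], n, ?_, hn₂, ?_⟩, ?_⟩
    · rw [← Category.assoc, hn₁, hm₁]
    · rw [← Category.assoc, hn₃, h.lift_fst]
    · rintro d' ⟨hd', n', hn₁', hn₂', hn₃'⟩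
      -- The image of a competitor `d'` in `X.W` is a transpose of `b ≫ p`, so uniqueness for `X`
      -- comes first and uniqueness for `T` applies over the same `c`.
      have hc' : d' ≫ T.w = c := by
        refine hu _ ⟨by rw [Category.assoc, hd'], n' ≫ T.fst, ?_, ?_, ?_⟩
        · rw [Category.assoc, hn₁']
        · rw [Category.assoc, T.isPullback.w, ← Category.assoc, hn₂', Category.assoc]
        · rw [Category.assoc, ← hn₃', Category.assoc, Category.assoc, h.w, ← Category.assoc T.ev,
            T.ev_comp]
      have hm' : n' ≫ T.fst = m := by
        apply X.isPullback.hom_ext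
        · rw [Category.assoc, hn₁', hm₁]
        · rw [Category.assoc, T.isPullback.w, ← Category.assoc, hn₂', Category.assoc, hc', hm₂]
      refine hu' d' ⟨hc', n', hm', hn₂', h.hom_ext ?_ ?_⟩
      · rw [Category.assoc, hn₃', h.lift_fst]
      · rw [Category.assoc, T.ev_comp, hm', h.lift_snd]

/-! ### Transposition and its naturality -/

namespace Exponential

variable {A D Z : C} {q : A ⟶ D} (X : Exponential q Z)

section

variable {Y P : C} {k : P ⟶ A} {g : P ⟶ Y} {y : Y ⟶ D} (sq : IsPullback k g q y)

/-- The map `Y ⟶ W` over `D` that corresponds to a map `Y ×_D A ⟶ Z`. -/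
noncomputable def curry (b : P ⟶ Z) : Y ⟶ X.W := (X.existsUnique sq b).choose

theorem curry_w (b : P ⟶ Z) : X.curry sq b ≫ X.w = y := (X.existsUnique sq b).choose_spec.1.1

theorem curry_unique {b : P ⟶ Z} {c : Y ⟶ X.W} (hc : c ≫ X.w = y) {m : P ⟶ X.R}
    (h₁ : m ≫ X.fst = k) (h₂ : m ≫ X.snd = g ≫ c) (h₃ : m ≫ X.ev = b) : c = X.curry sq b :=
  (X.existsUnique sq b).choose_spec.2 c ⟨hc, m, h₁, h₂, h₃⟩

/-- The map `Y ×_D A ⟶ Z` that corresponds to a map `Y ⟶ W` over `D`. -/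
noncomputable def uncurry (c : Y ⟶ X.W) (hc : c ≫ X.w = y) : P ⟶ Z :=
  X.isPullback.lift k (g ≫ c) (by rw [Category.assoc, hc, sq.w]) ≫ X.ev

theorem curry_uncurry (c : Y ⟶ X.W) (hc : c ≫ X.w = y) : X.curry sq (X.uncurry sq c hc) = c :=
  (X.curry_unique sq hc (X.isPullback.lift_fst _ _ _) (X.isPullback.lift_snd _ _ _) rfl).symm

theorem uncurry_curry (b : P ⟶ Z) : X.uncurry sq (X.curry sq b) (X.curry_w sq b) = b := by
  obtain ⟨m, hm₁, hm₂, hm₃⟩ := (X.existsUnique sq b).choose_spec.1.2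
  refine Eq.trans ?_ hm₃
  change _ ≫ _ = _
  congr 1
  apply X.isPullback.hom_ext
  · rw [X.isPullback.lift_fst, hm₁]
  · rw [X.isPullback.lift_snd, hm₂]; rfl

theorem curry_injective {b b' : P ⟶ Z} (h : X.curry sq b = X.curry sq b') : b = b' := by
  rw [← X.uncurry_curry sq b, ← X.uncurry_curry sq b']
  congr 1

end

section

variable {Y P : C} {k : P ⟶ A} {g : P ⟶ Y} {y : Y ⟶ D} (sq : IsPullback k g q y)
  {Y' P' : C} {k' : P' ⟶ A} {g' : P' ⟶ Y'} {y' : Y' ⟶ D} (sq' : IsPullback k' g' q y')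
  {h : Y' ⟶ Y} {m : P' ⟶ P}

/-- Both sides evaluate a map into `R`, and such maps are compared on the two projections. This
naturality gives stability of application. -/
theorem comp_uncurry (hm : m ≫ k = k') (hg : m ≫ g = g' ≫ h) (c : Y ⟶ X.W) (hc : c ≫ X.w = y)
    {c' : Y' ⟶ X.W} (hc' : c' ≫ X.w = y') (e : c' = h ≫ c) :
    m ≫ X.uncurry sq c hc = X.uncurry sq' c' hc' := by
  subst e
  change m ≫ _ ≫ _ = _ ≫ _
  rw [← Category.assoc]
  congr 1
  apply X.isPullback.hom_ext
  · rw [Category.assoc, X.isPullback.lift_fst, X.isPullback.lift_fst, hm]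
  · rw [Category.assoc, X.isPullback.lift_snd, X.isPullback.lift_snd, ← Category.assoc, hg,
      Category.assoc]

/-- Naturality of `uncurry`, transported through the bijection. This gives stability of formation
and abstraction. -/
theorem comp_curry (hm : m ≫ k = k') (hg : m ≫ g = g' ≫ h) (hy : h ≫ y = y') (b : P ⟶ Z) :
    h ≫ X.curry sq b = X.curry sq' (m ≫ b) := by
  have hw : (h ≫ X.curry sq b) ≫ X.w = y' := by rw [Category.assoc, X.curry_w, hy]
  have := X.comp_uncurry sq sq' hm hg (X.curry sq b) (X.curry_w sq b) hw rfl
  rw [uncurry_curry] at this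
  rw [this, curry_uncurry]

end

end Exponential

/-! ### Universes of dependent products -/

/-- The square `h` replaces `s ≫ p` by `e ≫ X.ev`, and `T.ev` lies over `T.fst`; what remains is
evaluation in `X` of a map determined by its projections. -/
theorem Exponential.uncurry_ofPushforward {A D E V E' : C} {q : A ⟶ D} {p : E ⟶ V}
    (X : Exponential q V) {s : E' ⟶ E} {e : E' ⟶ X.R} (h : IsPullback s e p X.ev)
    (T : PushforwardObj X.snd e) {Y P : C} {k : P ⟶ A} {g : P ⟶ Y} {y : Y ⟶ D}
    (sq : IsPullback k g q y) (c : Y ⟶ T.W) (hc : c ≫ T.w ≫ X.w = y)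
    (hc' : (c ≫ T.w) ≫ X.w = y) :
    X.uncurry sq (c ≫ T.w) hc' = (X.ofPushforward h T).uncurry sq c hc ≫ p := by
  obtain ⟨l, hl, hl₁, hl₂⟩ : ∃ l : P ⟶ T.R,
      (X.ofPushforward h T).uncurry sq c hc = l ≫ T.ev ≫ s ∧ l ≫ T.fst ≫ X.fst = k ∧
        l ≫ T.snd = g ≫ c :=
    ⟨(X.ofPushforward h T).isPullback.lift k (g ≫ c) 
      (sq.w.trans ((congrArg (g ≫ ·) hc.symm).trans (Category.assoc _ _ _).symm)), rfl,
      (X.ofPushforward h T).isPullback.lift_fst _ _ _,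
      (X.ofPushforward h T).isPullback.lift_snd _ _ _⟩
  rw [hl, Category.assoc, Category.assoc, h.w, ← Category.assoc T.ev, T.ev_comp, ← Category.assoc]
  change _ ≫ X.ev = _
  congr 1
  apply X.isPullback.hom_ext
  · rw [X.isPullback.lift_fst, Category.assoc, hl₁]
  · rw [X.isPullback.lift_snd, Category.assoc, T.isPullback.w, ← Category.assoc l, hl₂,
      Category.assoc]

/-- A universe of dependent products of families classified by `p : E ⟶ V` along `q`: a map
`π : U ⟶ W` with `W` and `U` exponentials of `V` and `E` such that `π` is induced by `p`. -/
structure PiUniverse (Q : MorphismProperty C) {A D E V : C} (q : A ⟶ D) (p : E ⟶ V) where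
  base : Exponential q V
  total : Exponential q E
  π : total.W ⟶ base.W
  fib : Q π
  π_w : π ≫ base.w = total.w
  uncurry_π {Y P : C} {k : P ⟶ A} {g : P ⟶ Y} {y : Y ⟶ D} (sq : IsPullback k g q y)
    (c : Y ⟶ total.W) (hc : c ≫ total.w = y) (hc' : (c ≫ π) ≫ base.w = y) :
    base.uncurry sq (c ≫ π) hc' = total.uncurry sq c hc ≫ p

namespace PiUniverse

variable {Q : MorphismProperty C} {A D E V : C} {q : A ⟶ D} {p : E ⟶ V} (T : PiUniverse Q q p)
  {Y P : C} {k : P ⟶ A} {g : P ⟶ Y} {y : Y ⟶ D} (sq : IsPullback k g q y)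

theorem curry_π (e : P ⟶ E) : T.total.curry sq e ≫ T.π = T.base.curry sq (e ≫ p) := by
  have h : (T.total.curry sq e ≫ T.π) ≫ T.base.w = y := by
    rw [Category.assoc, T.π_w, Exponential.curry_w]
  have := T.uncurry_π sq (T.total.curry sq e) (T.total.curry_w sq e) h
  rw [Exponential.uncurry_curry] at this
  rw [← this, Exponential.curry_uncurry]

theorem comp_w {b : P ⟶ V} {c : Y ⟶ T.total.W} (hc : c ≫ T.π = T.base.curry sq b) :
    c ≫ T.total.w = y := by
  rw [← T.π_w, ← Category.assoc, hc, Exponential.curry_w]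

/-- Transposing back is injective, and `curry_π` identifies both transposes with `c ≫ T.π`. Thus a
section of the product type transposes to a section of the family. -/
theorem uncurry_comp {b : P ⟶ V} {c : Y ⟶ T.total.W} (hc : c ≫ T.π = T.base.curry sq b) :
    T.total.uncurry sq c (T.comp_w sq hc) ≫ p = b := by
  apply T.base.curry_injective sq
  rw [← curry_π, Exponential.curry_uncurry, hc]

end PiUniverse

end Pushforward

/-! ### Existence of the universes -/

section

variable {B : Type u₁} [Category.{v₁} B] {C : Type u₂} [Category.{v₂} C]

/-- Universes of dependent products exist along the images of fibrations. -/
theorem nonempty_piUniverse (PB : MorphismProperty B) (PC : MorphismProperty C) [PC.HasPullbacks]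
    [PC.IsStableUnderBaseChange] (F : B ⥤ C)
    (hPi : ∀ {X Y : C} (g : X ⟶ Y), IsFFibration PB F g → HasFibrantPushforward PC g)
    {E V : B} (p : E ⟶ V) (hp : PB p) {E' V' : C} (p' : E' ⟶ V') (hp' : PC p')
    [HasBinaryProduct (F.obj E) V'] : Nonempty (PiUniverse PC (F.map p) p') := by
  obtain ⟨_, Pi, adj, -⟩ := hPi (F.map p)
    ⟨E, V, p, hp, 𝟙 _, 𝟙 _, IsPullback.id_horiz _⟩
  let X : Exponential (F.map p) V' :=
    (PushforwardObj.ofAdjunction (F.map p) adj prod.fst).exponential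
  -- The projection from the domain of evaluation to `X.W` is a pullback of `F.map p`, hence an
  -- `F`-fibration.
  obtain ⟨_, Pi', adj', hfib⟩ := hPi X.snd ⟨E, V, p, hp, X.fst, X.w, X.isPullback.flip.flip⟩
  have : HasPullback p' X.ev := PC.hasPullback X.ev hp'
  let T := PushforwardObj.ofAdjunction X.snd adj' (pullback.snd p' X.ev)
  have h := IsPullback.of_hasPullback p' X.ev
  refine ⟨⟨X, X.ofPushforward h T, T.w, ?_, rfl, ?_⟩⟩
  · exact hfib (Over.mk _) (PC.of_isPullback h hp')
  · intro Y P k g y sq c hc hc'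
    exact X.uncurry_ofPushforward h T sq c hc hc'

end

/-! ### Comparison maps of reindexed contexts -/

section LocalUniverses

variable {C : Type u} [Category.{v} C] {P : MorphismProperty C} [P.HasPullbacks]

namespace LocalCtx

/-- The equality is one of pairs, so the comparison map is transported along with the context; an
equality of contexts alone would not suffice. -/
theorem eqToHom_comp_snd {X Y : C} {s s' : Σ Δ : LocalCtx P X, Δ.obj ⟶ Y} (h : s = s') :
    eqToHom (by rw [h]) ≫ s'.2 = s.2 := by
  subst h; simp

theorem reindex_id {X : C} (Δ : LocalCtx P X) : Δ.reindex (𝟙 X) = Δ :=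
  congrArg Sigma.fst Δ.tele.reindex_id

theorem reindex_comp {X X' X'' : C} (g : X'' ⟶ X') (f : X' ⟶ X) (Δ : LocalCtx P X) :
    Δ.reindex (g ≫ f) = (Δ.reindex f).reindex g :=
  congrArg Sigma.fst (Δ.tele.reindex_comp g f)

/-- The comparison map of a reindexed context, up to an equality of contexts. -/
noncomputable def transMap {X X' : C} (f : X' ⟶ X) {Δ : LocalCtx P X} {Θ : LocalCtx P X'}
    (h : Δ.reindex f = Θ) : Θ.obj ⟶ Δ.obj :=
  eqToHom (congrArg LocalCtx.obj h.symm) ≫ Δ.reindexMap f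

theorem transMap_rfl {X X' : C} (f : X' ⟶ X) (Δ : LocalCtx P X) :
    transMap f (rfl : Δ.reindex f = _) = Δ.reindexMap f :=
  Category.id_comp _

theorem transMap_congr {X X' : C} {f f' : X' ⟶ X} (w : f = f') {Δ : LocalCtx P X}
    {Θ : LocalCtx P X'} (h : Δ.reindex f = Θ) : transMap f h = transMap f' (w ▸ h) := by
  subst w; rfl

theorem transMap_id {X : C} (Δ : LocalCtx P X) : transMap (𝟙 X) Δ.reindex_id = 𝟙 Δ.obj :=
  eqToHom_comp_snd Δ.tele.reindex_id.symm

theorem transMap_comp {X X' X'' : C} {g : X'' ⟶ X'} {f : X' ⟶ X} {Δ : LocalCtx P X}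
    {Θ : LocalCtx P X'} {Ξ : LocalCtx P X''} (h : Δ.reindex f = Θ) (h' : Θ.reindex g = Ξ) :
    transMap g h' ≫ transMap f h = transMap (g ≫ f) ((Δ.reindex_comp g f).trans (h ▸ h')) := by
  subst h h'
  rw [transMap_rfl, transMap_rfl]
  exact (eqToHom_comp_snd (Δ.tele.reindex_comp g f).symm).symm

theorem transMap_proj {X X' : C} (f : X' ⟶ X) {Δ : LocalCtx P X} {Θ : LocalCtx P X'}
    (h : Δ.reindex f = Θ) : transMap f h ≫ Δ.tele.proj = Θ.tele.proj ≫ f := by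
  subst h
  simpa [transMap] using (Δ.isPullback_reindex f).w

theorem transMap_reindexMap_of_section {X X' : C} {f : X' ⟶ X} {s : X ⟶ X'} (w : s ≫ f = 𝟙 X)
    {Δ : LocalCtx P X} (h : (Δ.reindex f).reindex s = Δ) :
    transMap s h ≫ Δ.reindexMap f = 𝟙 _ := by
  rw [← transMap_rfl, transMap_comp, transMap_congr w, transMap_id]

/-- Both composites are comparison maps for the common map `a ≫ b = a' ≫ b'`. -/
theorem transMap_reindexMap {X Y Y' Z : C} {a : Z ⟶ Y} {b : Y ⟶ X} {a' : Z ⟶ Y'} {b' : Y' ⟶ X}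
    (w : a ≫ b = a' ≫ b') {Δ : LocalCtx P X}
    (h : (Δ.reindex b).reindex a = (Δ.reindex b').reindex a') :
    transMap a h ≫ Δ.reindexMap b = (Δ.reindex b').reindexMap a' ≫ Δ.reindexMap b' := by
  rw [← transMap_rfl, ← transMap_rfl, ← transMap_rfl, transMap_comp, transMap_congr w,
    transMap_comp]

end LocalCtx

/-! ### Terms as elements -/

namespace localUniverses

variable {X : C} {Δ : LocalCtx P X} {A : LocalTy P Δ.obj}

/-- The underlying section of a term. -/
noncomputable def toSection (t : (localUniverses P X).Tm (Γ := Δ) A) : Δ.obj ⟶ A.ext :=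
  LocalCtx.Hom.hom t.hom

theorem toSection_proj (t : (localUniverses P X).Tm (Γ := Δ) A) :
    toSection t ≫ A.proj = 𝟙 Δ.obj :=
  congrArg LocalCtx.Hom.hom t.hom_proj

/-- The element `Δ ⟶ E` of a type `Δ ⟶ V ↞ E` that corresponds to a term. -/
noncomputable def elem (t : (localUniverses P X).Tm (Γ := Δ) A) : Δ.obj ⟶ A.E :=
  toSection t ≫ A.elt

theorem elem_p (t : (localUniverses P X).Tm (Γ := Δ) A) : elem t ≫ A.p = A.r := by
  rw [elem, Category.assoc, A.isPullback_elt.w, ← Category.assoc, toSection_proj, Category.id_comp]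

/-- The term that corresponds to an element. -/
noncomputable def ofElem (A : LocalTy P Δ.obj) (e : Δ.obj ⟶ A.E) (he : e ≫ A.p = A.r) :
    (localUniverses P X).Tm (Γ := Δ) A where
  hom := LocalCtx.Hom.mk (A.isPullback_elt.lift e (𝟙 _) (by rw [he, Category.id_comp]))
    ((Category.assoc _ _ _).symm.trans
      ((congrArg (· ≫ Δ.tele.proj) (A.isPullback_elt.lift_snd _ _ _)).trans (Category.id_comp _)))
  hom_proj := LocalCtx.hom_ext (A.isPullback_elt.lift_snd _ _ _)

theorem elem_ofElem (A : LocalTy P Δ.obj) (e : Δ.obj ⟶ A.E) (he : e ≫ A.p = A.r) :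
    elem (ofElem A e he) = e :=
  A.isPullback_elt.lift_fst _ _ _

/-- A map into the pullback `A.ext` is determined by its element and its projection, and the
projection of a term is the identity. -/
theorem elem_injective {t t' : (localUniverses P X).Tm (Γ := Δ) A} (h : elem t = elem t') :
    t = t' := by
  have e : t.hom = t'.hom := LocalCtx.hom_ext
    (A.isPullback_elt.hom_ext h ((toSection_proj t).trans (toSection_proj t').symm))
  obtain ⟨f, hf⟩ := t
  obtain ⟨g, hg⟩ := t'
  dsimp at e
  subst e
  rfl

theorem elem_sub {Θ : LocalCtx P X} (t : (localUniverses P X).Tm (Γ := Δ) A)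
    (f : Θ ⟶ Δ) : elem (A := A.sub f.hom) (t.sub f) = f.hom ≫ elem t := by
  have h : toSection (A := A.sub f.hom) (t.sub f) ≫ A.lift f.hom = f.hom ≫ toSection t :=
    congrArg LocalCtx.Hom.hom (t.sub_lift f)
  refine (congrArg (toSection (A := A.sub f.hom) (t.sub f) ≫ ·) (A.lift_elt f.hom)).symm.trans ?_
  exact (Category.assoc _ _ _).symm.trans
    ((congrArg (· ≫ A.elt) h).trans (Category.assoc _ _ _))

theorem elem_reindex {X' : C} (f : X' ⟶ X) (t : (localUniverses P X).Tm (Γ := Δ) A) :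
    elem (Δ := Δ.reindex f) (A := A.sub (Δ.reindexMap f)) ((localUniversesReindex P f).tm t) =
      Δ.reindexMap f ≫ elem t := by
  have h' : ((localUniversesReindex P f).tm t).hom = LocalCtx.reindexHom f t.hom :=
    Category.comp_id _
  have h : toSection (Δ := Δ.reindex f) (A := A.sub (Δ.reindexMap f))
      ((localUniversesReindex P f).tm t) ≫ A.lift (Δ.reindexMap f) =
        Δ.reindexMap f ≫ toSection t :=
    (congrArg (fun m : Δ.reindex f ⟶ (Δ.ext A).reindex f =>
      m.hom ≫ A.lift (Δ.reindexMap f)) h').trans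
      (LocalCtx.reindexHom_map f t.hom)
  refine (congrArg (toSection (Δ := Δ.reindex f) (A := A.sub (Δ.reindexMap f))
    ((localUniversesReindex P f).tm t) ≫ ·) (A.lift_elt (Δ.reindexMap f))).symm.trans ?_
  exact (Category.assoc _ _ _).symm.trans
    ((congrArg (· ≫ A.elt) h).trans (Category.assoc _ _ _))

theorem elem_castTy {A' : LocalTy P Δ.obj} (h : A = A') (t : (localUniverses P X).Tm (Γ := Δ) A) :
    HEq (elem (A := A') (t.castTy h)) (elem t) := by
  subst h; rfl

/-- The objects `A.E` and `A'.E` are only propositionally equal, hence the `HEq`. The casts in the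
stability laws are discharged here, on elements. -/
theorem castTy_eq {A' : LocalTy P Δ.obj} (h : A = A') {t : (localUniverses P X).Tm (Γ := Δ) A}
    {t' : (localUniverses P X).Tm (Γ := Δ) A'} (ht : HEq (elem t) (elem t')) :
    t.castTy h = t' := by
  subst h; exact elem_injective (eq_of_heq ht)

/-- Turns a reindexed type transported along an equality of contexts into an ordinary substitution;
`instTy` and `reUnderTy` are both of this form. -/
theorem castTy_reindex_ty {X' : C} (f : X' ⟶ X) {Θ : LocalCtx P X'} (h : Δ.reindex f = Θ)
    (A : LocalTy P Δ.obj) :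
    castTy (K := localUniverses P X') h ((localUniversesReindex P f).ty (Γ := Δ) A) =
      A.sub (LocalCtx.transMap f h) := by
  subst h
  refine congrArg (fun m => A.sub m) ?_
  simp [LocalCtx.transMap]

theorem elem_castCtx_reindex {X' : C} (f : X' ⟶ X) {Θ : LocalCtx P X'} (h : Δ.reindex f = Θ)
    (t : (localUniverses P X).Tm (Γ := Δ) A) :
    HEq (elem (Δ := Θ)
      (A := castTy (K := localUniverses P X') h ((localUniversesReindex P f).ty (Γ := Δ) A))
      (((localUniversesReindex P f).tm t).castCtx h)) (LocalCtx.transMap f h ≫ elem t) := by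
  subst h
  refine heq_of_eq ((elem_reindex f t).trans ?_)
  simp [LocalCtx.transMap]

end localUniverses

end LocalUniverses

/-! ### Dependent products over a pullback square -/

section LocalPi

variable {C : Type u} [Category.{v} C]

theorem comp_heq_comp {X Y Z Z' : C} (f : X ⟶ Y) (e : Z = Z') {g : Y ⟶ Z} {g' : Y ⟶ Z'}
    (h : HEq g g') : HEq (f ≫ g) (f ≫ g') := by
  subst e; cases h; rfl

variable {Q : MorphismProperty C} [Q.HasPullbacks]

namespace LocalCtx

/-- Pasting the weakening square on top of `sq` makes the weakened context a pullback of `q` itself,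
so that exponentials along `q` classify families over it. -/
theorem isPullback_paste {X X' A D : C} {el : X' ⟶ A} {pr : X' ⟶ X} {q : A ⟶ D} {r : X ⟶ D}
    (sq : IsPullback el pr q r) (Δ : LocalCtx Q X) :
    IsPullback ((Δ.reindex pr).tele.proj ≫ el) (Δ.reindexMap pr) q (Δ.tele.proj ≫ r) :=
  (Δ.isPullback_reindex pr).flip.paste_horiz sq

/-- The weakening of `Δ` is a pullback. On `Δ` both sections cancel and leave `Δ.reindexMap σ`; on
`X'` the two sides agree by `hl`. -/
theorem transMap_section_comp {X X' X₁ X₁' : C} {pr : X' ⟶ X} {pr₁ : X₁' ⟶ X₁} {σ : X₁ ⟶ X}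
    {l : X₁' ⟶ X'} (w : l ≫ pr = pr₁ ≫ σ) {s : X ⟶ X'} (hs : s ≫ pr = 𝟙 X) {s₁ : X₁ ⟶ X₁'}
    (hs₁ : s₁ ≫ pr₁ = 𝟙 X₁) (hl : s₁ ≫ l = σ ≫ s) {Δ : LocalCtx Q X}
    (h : (Δ.reindex pr).reindex s = Δ)
    (h₁ : ((Δ.reindex σ).reindex pr₁).reindex s₁ = Δ.reindex σ)
    (h₂ : (Δ.reindex pr).reindex l = (Δ.reindex σ).reindex pr₁) :
    transMap s₁ h₁ ≫ transMap l h₂ = Δ.reindexMap σ ≫ transMap s h := by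
  apply (Δ.isPullback_reindex pr).hom_ext
  · rw [Category.assoc, transMap_reindexMap w, ← Category.assoc,
      transMap_reindexMap_of_section hs₁, Category.assoc, transMap_reindexMap_of_section hs,
      Category.id_comp, Category.comp_id]
  · rw [Category.assoc, transMap_proj, ← Category.assoc, transMap_proj, Category.assoc, hl,
      Category.assoc, transMap_proj, ← Category.assoc, ← Category.assoc,
      (Δ.isPullback_reindex σ).w]

theorem transMap_section_comp_self {X X' X₁' : C} {pr : X' ⟶ X} {pr₁ : X₁' ⟶ X'}
    {l : X₁' ⟶ X'} {s₁ : X' ⟶ X₁'} (hl : s₁ ≫ l = 𝟙 X') {Δ : LocalCtx Q X}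
    (h₁ : ((Δ.reindex pr).reindex pr₁).reindex s₁ = Δ.reindex pr)
    (h₂ : (Δ.reindex pr).reindex l = (Δ.reindex pr).reindex pr₁) :
    transMap s₁ h₁ ≫ transMap l h₂ = 𝟙 _ := by
  rw [transMap_comp, transMap_congr hl, transMap_id]

theorem transMap_section_comp_reindexHom {X X' : C} {pr : X' ⟶ X} {s : X ⟶ X'}
    (hs : s ≫ pr = 𝟙 X) {Δ Δ' : LocalCtx Q X} (τ : Δ' ⟶ Δ)
    (h : (Δ.reindex pr).reindex s = Δ) (h' : (Δ'.reindex pr).reindex s = Δ') :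
    transMap s h' ≫ (reindexHom pr τ).hom = τ.hom ≫ transMap s h := by
  apply (Δ.isPullback_reindex pr).hom_ext
  · rw [Category.assoc, reindexHom_map, ← Category.assoc, transMap_reindexMap_of_section hs,
      Category.assoc, transMap_reindexMap_of_section hs, Category.id_comp, Category.comp_id]
  · rw [Category.assoc, (reindexHom pr τ).w, transMap_proj, Category.assoc, transMap_proj,
      ← Category.assoc, τ.w]

end LocalCtx

open localUniverses

variable {A D : C} {q : A ⟶ D} (T : ∀ {E V : C} {p : E ⟶ V}, Q p → PiUniverse Q q p)

section

variable {X X' : C} {el : X' ⟶ A} {pr : X' ⟶ X} {r : X ⟶ D} (sq : IsPullback el pr q r)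
  {Δ : LocalCtx Q X}

/-- The dependent product of a type `B` over a context `Δ` weakened along `pr : X' ⟶ X`. -/
noncomputable def piTy (B : LocalTy Q (Δ.reindex pr).obj) : LocalTy Q Δ.obj where
  V := (T B.fib).base.W
  E := (T B.fib).total.W
  p := (T B.fib).π
  fib := (T B.fib).fib
  r := (T B.fib).base.curry (Δ.isPullback_paste sq) B.r

variable {B : LocalTy Q (Δ.reindex pr).obj}

/-- Abstraction. -/
noncomputable def piLam (b : (localUniverses Q X').Tm (Γ := Δ.reindex pr) B) :
    (localUniverses Q X).Tm (Γ := Δ) (piTy T sq B) :=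
  ofElem (piTy T sq B) ((T B.fib).total.curry (Δ.isPullback_paste sq) (elem b))
    (((T B.fib).curry_π _ _).trans
      (congrArg ((T B.fib).base.curry (Δ.isPullback_paste sq)) (elem_p b)))

/-- Generic application: the map underlying a term of a dependent product. -/
noncomputable def piFun (f : (localUniverses Q X).Tm (Γ := Δ) (piTy T sq B)) :
    (Δ.reindex pr).obj ⟶ B.E :=
  (T B.fib).total.uncurry (Δ.isPullback_paste sq) (elem f)
    ((T B.fib).comp_w (Δ.isPullback_paste sq) (elem_p f))

theorem piFun_p (f : (localUniverses Q X).Tm (Γ := Δ) (piTy T sq B)) :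
    piFun T sq f ≫ B.p = B.r :=
  (T B.fib).uncurry_comp _ (elem_p f)

theorem elem_piLam (b : (localUniverses Q X').Tm (Γ := Δ.reindex pr) B) :
    elem (piLam T sq b) = (T B.fib).total.curry (Δ.isPullback_paste sq) (elem b) :=
  elem_ofElem _ _ _

/-- The generic β rule; the rule at a term `j` follows by precomposing with the instantiation map.
-/
theorem piFun_piLam (b : (localUniverses Q X').Tm (Γ := Δ.reindex pr) B) :
    piFun T sq (piLam T sq b) = elem b := by
  refine Eq.trans ?_ ((T B.fib).total.uncurry_curry (Δ.isPullback_paste sq) (elem b))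
  unfold piFun
  congr 1
  exact elem_piLam T sq b

theorem piLam_eq {b : (localUniverses Q X').Tm (Γ := Δ.reindex pr) B}
    {f : (localUniverses Q X).Tm (Γ := Δ) (piTy T sq B)} (h : elem b = piFun T sq f) :
    piLam T sq b = f := by
  apply elem_injective
  rw [elem_piLam, h]
  exact (T B.fib).total.curry_uncurry _ _ _

end

section

variable {X X' : C} {el : X' ⟶ A} {pr : X' ⟶ X} {r : X ⟶ D} (sq : IsPullback el pr q r)
  {Δ : LocalCtx Q X} (B : LocalTy Q (Δ.reindex pr).obj)
  {X₁ X₁' : C} {el₁ : X₁' ⟶ A} {pr₁ : X₁' ⟶ X₁} {r₁ : X₁ ⟶ D} (sq₁ : IsPullback el₁ pr₁ q r₁)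
  {Δ₁ : LocalCtx Q X₁} {h : Δ₁.obj ⟶ Δ.obj} {m : (Δ₁.reindex pr₁).obj ⟶ (Δ.reindex pr).obj}

/-- Both types have the same `V`, `E` and `p`, because these depend only on `B.p`; the classifying
maps agree by naturality of currying. Leaving `m` and `h` abstract covers base reindexing and
substitution in the fibre alike. -/
theorem piTy_sub
    (hm : m ≫ (Δ.reindex pr).tele.proj ≫ el = (Δ₁.reindex pr₁).tele.proj ≫ el₁)
    (hg : m ≫ Δ.reindexMap pr = Δ₁.reindexMap pr₁ ≫ h)
    (hy : h ≫ Δ.tele.proj ≫ r = Δ₁.tele.proj ≫ r₁) :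
    (piTy T sq B).sub h = piTy T sq₁ (B.sub m) :=
  congrArg (fun c => ({
      V := (T B.fib).base.W
      E := (T B.fib).total.W
      p := (T B.fib).π
      fib := (T B.fib).fib
      r := c } : LocalTy Q Δ₁.obj))
    ((T B.fib).base.comp_curry (Δ.isPullback_paste sq) (Δ₁.isPullback_paste sq₁) hm hg hy B.r)

variable {B}

/-- The type `B₁` is kept separate from `B.sub m` because `reUnderTy`, being a transport, equals a
substitution only propositionally. -/
theorem elem_piLam_heq
    (hm : m ≫ (Δ.reindex pr).tele.proj ≫ el = (Δ₁.reindex pr₁).tele.proj ≫ el₁)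
    (hg : m ≫ Δ.reindexMap pr = Δ₁.reindexMap pr₁ ≫ h)
    (hy : h ≫ Δ.tele.proj ≫ r = Δ₁.tele.proj ≫ r₁)
    {B₁ : LocalTy Q (Δ₁.reindex pr₁).obj} (e : B₁ = B.sub m)
    {b : (localUniverses Q X').Tm (Γ := Δ.reindex pr) B}
    {b₁ : (localUniverses Q X₁').Tm (Γ := Δ₁.reindex pr₁) B₁}
    (hb : HEq (elem b₁) (m ≫ elem b)) :
    HEq (elem (piLam T sq₁ b₁)) (h ≫ elem (piLam T sq b)) := by
  subst e
  rw [elem_piLam, elem_piLam, eq_of_heq hb]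
  exact heq_of_eq ((T B.fib).total.comp_curry (Δ.isPullback_paste sq) (Δ₁.isPullback_paste sq₁)
    hm hg hy (elem b)).symm

theorem piFun_heq
    (hm : m ≫ (Δ.reindex pr).tele.proj ≫ el = (Δ₁.reindex pr₁).tele.proj ≫ el₁)
    (hg : m ≫ Δ.reindexMap pr = Δ₁.reindexMap pr₁ ≫ h)
    {B₁ : LocalTy Q (Δ₁.reindex pr₁).obj} (e : B₁ = B.sub m)
    {f : (localUniverses Q X).Tm (Γ := Δ) (piTy T sq B)}
    {f₁ : (localUniverses Q X₁).Tm (Γ := Δ₁) (piTy T sq₁ B₁)}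
    (hf : HEq (elem f₁) (h ≫ elem f)) :
    HEq (piFun T sq₁ f₁) (m ≫ piFun T sq f) := by
  subst e
  exact heq_of_eq ((T B.fib).total.comp_uncurry (Δ.isPullback_paste sq) (Δ₁.isPullback_paste sq₁)
    hm hg (elem f) _ _ (eq_of_heq hf)).symm

end

end LocalPi

/-! ### Instantiation and reindexing after change of base -/

section

open localUniverses Indexed

variable {B : Type u₁} [Category.{v₁} B] {C : Type u₂} [Category.{v₂} C]
  {PB : MorphismProperty B} [PB.HasPullbacks] {PC : MorphismProperty C} [PC.HasPullbacks]
  {F : B ⥤ C}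

/-- Here preservation of pullbacks enters. The flips are needed because `hF` has the fibration as
the second leg of the cospan. -/
theorem LocalTy.map_isPullback
    (hF : ∀ {X V E : B} (r : X ⟶ V) (p : E ⟶ V), PB p → PreservesLimit (cospan r p) F)
    {Y : B} (I : LocalTy PB Y) :
    IsPullback (F.map I.elt) (F.map I.proj) (F.map I.p) (F.map I.r) := by
  have := hF I.r I.p I.fib
  exact (I.isPullback_elt.flip.map F).flip

variable [HasTerminal B]

namespace changeOfBase

variable {Γ Γ' : LocalCtx PB (⊤_ B)} {I : LocalTy PB Γ.obj}

theorem map_section (j : (localUniversesTop PB).Tm (Γ := Γ) I) :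
    F.map (toSection j) ≫ F.map I.proj = 𝟙 _ := by
  rw [← F.map_comp, toSection_proj, F.map_id]

theorem map_lift_proj (σ : Γ' ⟶ Γ) (I : LocalTy PB Γ.obj) :
    F.map (I.lift σ.hom) ≫ F.map I.proj = F.map (I.sub σ.hom).proj ≫ F.map σ.hom := by
  rw [← F.map_comp, I.lift_proj, F.map_comp]

theorem map_section_lift (σ : Γ' ⟶ Γ) (j : (localUniversesTop PB).Tm (Γ := Γ) I) :
    F.map (toSection (A := I.sub σ.hom) (j.sub σ)) ≫ F.map (I.lift σ.hom) =
      F.map σ.hom ≫ F.map (toSection j) := by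
  rw [← F.map_comp, ← F.map_comp]
  exact congrArg (fun f => F.map (LocalCtx.Hom.hom f)) (j.sub_lift σ)

theorem map_var_lift (I : LocalTy PB Γ.obj) :
    F.map (toSection (Δ := Γ.ext I) (A := I.sub I.proj)
        (var (K := localUniversesTop PB) (Γ := Γ) I)) ≫
      F.map (I.lift I.proj) = 𝟙 _ := by
  refine (F.map_comp _ _).symm.trans (Eq.trans ?_ (F.map_id _))
  exact congrArg (fun f => F.map (LocalCtx.Hom.hom f))
    (var_lift (K := localUniversesTop PB) (Γ := Γ) I)

/-- The map `Δ ⟶ (Δ weakened by I)` given by an element of `I`. -/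
noncomputable def instMap (j : (localUniversesTop PB).Tm (Γ := Γ) I)
    (Δ : LocalCtx PC (F.obj Γ.obj)) : Δ.obj ⟶ (Δ.reindex (F.map I.proj)).obj :=
  LocalCtx.transMap (F.map (toSection j)) (inst_obj (D := changeOfBase PB PC F) j Δ)

theorem instTy_eq (j : (localUniversesTop PB).Tm (Γ := Γ) I) (Δ : LocalCtx PC (F.obj Γ.obj))
    (A : LocalTy PC (Δ.reindex (F.map I.proj)).obj) :
    instTy (D := changeOfBase PB PC F) j (Δ := Δ) A = A.sub (instMap j Δ) :=
  castTy_reindex_ty _ _ _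

theorem elem_instTm (j : (localUniversesTop PB).Tm (Γ := Γ) I) {Δ : LocalCtx PC (F.obj Γ.obj)}
    {A : LocalTy PC (Δ.reindex (F.map I.proj)).obj}
    (a : (localUniverses PC (F.obj I.ext)).Tm (Γ := Δ.reindex (F.map I.proj)) A) :
    HEq (elem (X := F.obj Γ.obj) (Δ := Δ) (A := instTy (D := changeOfBase PB PC F) j (Δ := Δ) A)
      (instTm (D := changeOfBase PB PC F) j (Δ := Δ) a)) (instMap j Δ ≫ elem a) :=
  elem_castCtx_reindex _ _ _

/-- The map from the weakening of a reindexed context to the weakening of the context. -/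
noncomputable def underMap (σ : Γ' ⟶ Γ) (I : LocalTy PB Γ.obj) (Δ : LocalCtx PC (F.obj Γ.obj)) :
    ((Δ.reindex (F.map σ.hom)).reindex (F.map (I.sub σ.hom).proj)).obj ⟶
      (Δ.reindex (F.map I.proj)).obj :=
  LocalCtx.transMap (F.map (I.lift σ.hom)) (reUnder_obj (D := changeOfBase PB PC F) σ I Δ)

theorem reUnderTy_eq (σ : Γ' ⟶ Γ) {Δ : LocalCtx PC (F.obj Γ.obj)}
    (A : LocalTy PC (Δ.reindex (F.map I.proj)).obj) :
    reUnderTy (D := changeOfBase PB PC F) σ (I := I) (Δ := Δ) A = A.sub (underMap σ I Δ) :=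
  castTy_reindex_ty _ _ _

theorem elem_reUnderTm (σ : Γ' ⟶ Γ) {Δ : LocalCtx PC (F.obj Γ.obj)}
    {A : LocalTy PC (Δ.reindex (F.map I.proj)).obj}
    (a : (localUniverses PC (F.obj I.ext)).Tm (Γ := Δ.reindex (F.map I.proj)) A) :
    HEq (elem (X := F.obj (I.sub σ.hom).ext)
      (Δ := (Δ.reindex (F.map σ.hom)).reindex (F.map (I.sub σ.hom).proj))
      (A := reUnderTy (D := changeOfBase PB PC F) σ (I := I) (Δ := Δ) A)
      (reUnderTm (D := changeOfBase PB PC F) σ (I := I) (Δ := Δ) a)) (underMap σ I Δ ≫ elem a) :=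
  elem_castCtx_reindex _ _ _

theorem underMap_proj (σ : Γ' ⟶ Γ) (I : LocalTy PB Γ.obj) (Δ : LocalCtx PC (F.obj Γ.obj)) :
    underMap σ I Δ ≫ (Δ.reindex (F.map I.proj)).tele.proj =
      ((Δ.reindex (F.map σ.hom)).reindex (F.map (I.sub σ.hom).proj)).tele.proj ≫
        F.map (I.lift σ.hom) :=
  LocalCtx.transMap_proj _ _

theorem underMap_elt (σ : Γ' ⟶ Γ) (I : LocalTy PB Γ.obj) (Δ : LocalCtx PC (F.obj Γ.obj)) :
    underMap σ I Δ ≫ (Δ.reindex (F.map I.proj)).tele.proj ≫ F.map I.elt =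
      ((Δ.reindex (F.map σ.hom)).reindex (F.map (I.sub σ.hom).proj)).tele.proj ≫
        F.map (I.sub σ.hom).elt := by
  rw [← Category.assoc, underMap_proj, Category.assoc, ← F.map_comp, I.lift_elt]

theorem underMap_reindexMap (σ : Γ' ⟶ Γ) (I : LocalTy PB Γ.obj) (Δ : LocalCtx PC (F.obj Γ.obj)) :
    underMap σ I Δ ≫ Δ.reindexMap (F.map I.proj) =
      (Δ.reindex (F.map σ.hom)).reindexMap (F.map (I.sub σ.hom).proj) ≫
        Δ.reindexMap (F.map σ.hom) :=
  LocalCtx.transMap_reindexMap (map_lift_proj σ I) _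

theorem reindexMap_classifier (σ : Γ' ⟶ Γ) (I : LocalTy PB Γ.obj)
    (Δ : LocalCtx PC (F.obj Γ.obj)) :
    Δ.reindexMap (F.map σ.hom) ≫ Δ.tele.proj ≫ F.map I.r =
      (Δ.reindex (F.map σ.hom)).tele.proj ≫ F.map (I.sub σ.hom).r := by
  rw [← Category.assoc, (Δ.isPullback_reindex _).w, Category.assoc, ← F.map_comp]

/-- The map form of `B[j/i][σ] = B[σ, i][j[σ]/i]`. -/
theorem instMap_underMap (σ : Γ' ⟶ Γ) (j : (localUniversesTop PB).Tm (Γ := Γ) I)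
    (Δ : LocalCtx PC (F.obj Γ.obj)) :
    instMap (I := I.sub σ.hom) (j.sub σ) (Δ.reindex (F.map σ.hom)) ≫ underMap σ I Δ =
      Δ.reindexMap (F.map σ.hom) ≫ instMap j Δ :=
  LocalCtx.transMap_section_comp (map_lift_proj σ I) (map_section j)
    (map_section (I := I.sub σ.hom) (j.sub σ)) (map_section_lift σ j) _ _ _

/-- The map form of `B[σ, i][i/i] = B`, for `σ` the projection. -/
theorem instMap_var (I : LocalTy PB Γ.obj) (Δ : LocalCtx PC (F.obj Γ.obj)) :
    instMap (Γ := Γ.ext I) (I := I.sub I.proj) (var (K := localUniversesTop PB) (Γ := Γ) I)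
      (Δ.reindex (F.map I.proj)) ≫ underMap (LocalCtx.projHom I) I Δ = 𝟙 _ :=
  LocalCtx.transMap_section_comp_self (map_var_lift I) _ _

theorem instMap_reindexHom (j : (localUniversesTop PB).Tm (Γ := Γ) I)
    {Δ Δ' : LocalCtx PC (F.obj Γ.obj)} (τ : Δ' ⟶ Δ) :
    instMap j Δ' ≫ (LocalCtx.reindexHom (F.map I.proj) τ).hom = τ.hom ≫ instMap j Δ :=
  LocalCtx.transMap_section_comp_reindexHom (map_section j) τ _ _

theorem reindexHom_elt (I : LocalTy PB Γ.obj) {Δ Δ' : LocalCtx PC (F.obj Γ.obj)} (τ : Δ' ⟶ Δ) :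
    (LocalCtx.reindexHom (F.map I.proj) τ).hom ≫ (Δ.reindex (F.map I.proj)).tele.proj ≫
        F.map I.elt = (Δ'.reindex (F.map I.proj)).tele.proj ≫ F.map I.elt := by
  rw [← Category.assoc, (LocalCtx.reindexHom (F.map I.proj) τ).w]

theorem hom_classifier (I : LocalTy PB Γ.obj) {Δ Δ' : LocalCtx PC (F.obj Γ.obj)} (τ : Δ' ⟶ Δ) :
    τ.hom ≫ Δ.tele.proj ≫ F.map I.r = Δ'.tele.proj ≫ F.map I.r := by
  rw [← Category.assoc, τ.w]

section Application

variable (T : ∀ {E V : B} {p : E ⟶ V}, PB p → ∀ {E' V' : C} {p' : E' ⟶ V'}, PC p' →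
    PiUniverse PC (F.map p) p')
  (hF : ∀ {X V E : B} (r : X ⟶ V) (p : E ⟶ V), PB p → PreservesLimit (cospan r p) F)
  {Δ : LocalCtx PC (F.obj Γ.obj)} {A : LocalTy PC (Δ.reindex (F.map I.proj)).obj}

/-- Application. -/
noncomputable def piApp
    (f : (localUniverses PC (F.obj Γ.obj)).Tm (Γ := Δ)
      (piTy (T I.fib) (LocalTy.map_isPullback hF I) A))
    (j : (localUniversesTop PB).Tm (Γ := Γ) I) :
    (localUniverses PC (F.obj Γ.obj)).Tm (Γ := Δ)
      (instTy (D := changeOfBase PB PC F) j (Δ := Δ) A) :=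
  -- Application at `j` restricts the generic application `piFun` along the instantiation map.
  (ofElem (A.sub (instMap j Δ)) (instMap j Δ ≫ piFun (T I.fib) (LocalTy.map_isPullback hF I) f)
    (by rw [Category.assoc, piFun_p])).castTy (instTy_eq j Δ A).symm

theorem elem_piApp
    (f : (localUniverses PC (F.obj Γ.obj)).Tm (Γ := Δ)
      (piTy (T I.fib) (LocalTy.map_isPullback hF I) A))
    (j : (localUniversesTop PB).Tm (Γ := Γ) I) :
    HEq (elem (X := F.obj Γ.obj) (Δ := Δ) (A := instTy (D := changeOfBase PB PC F) j (Δ := Δ) A)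
      (piApp T hF f j)) (instMap j Δ ≫ piFun (T I.fib) (LocalTy.map_isPullback hF I) f) :=
  (elem_castTy _ _).trans (heq_of_eq (elem_ofElem _ _ _))

end Application

end changeOfBase

end

/-! ### Stability, β and η -/

section

open localUniverses Indexed

variable {B : Type u₁} [Category.{v₁} B] {C : Type u₂} [Category.{v₂} C]
  [HasTerminal B] {PB : MorphismProperty B} [PB.HasPullbacks]
  {PC : MorphismProperty C} [PC.HasPullbacks] {F : B ⥤ C}

namespace changeOfBase

variable {Γ Γ' : LocalCtx PB (⊤_ B)} {I : LocalTy PB Γ.obj}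
  (T : ∀ {E V : B} {p : E ⟶ V}, PB p → ∀ {E' V' : C} {p' : E' ⟶ V'}, PC p' →
    PiUniverse PC (F.map p) p')
  (hF : ∀ {X V E : B} (r : X ⟶ V) (p : E ⟶ V), PB p → PreservesLimit (cospan r p) F)
  {Δ : LocalCtx PC (F.obj Γ.obj)} {A : LocalTy PC (Δ.reindex (F.map I.proj)).obj}

theorem piTy_re (σ : Γ' ⟶ Γ) (A : LocalTy PC (Δ.reindex (F.map I.proj)).obj) :
    (piTy (T I.fib) (LocalTy.map_isPullback hF I) A).sub (Δ.reindexMap (F.map σ.hom)) =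
      piTy (T I.fib) (LocalTy.map_isPullback hF (I.sub σ.hom))
        (reUnderTy (D := changeOfBase PB PC F) σ (I := I) (Δ := Δ) A) :=
  (piTy_sub (T I.fib) (LocalTy.map_isPullback hF I) A (LocalTy.map_isPullback hF (I.sub σ.hom))
    (underMap_elt σ I Δ) (underMap_reindexMap σ I Δ) (reindexMap_classifier σ I Δ)).trans
    (congrArg _ (reUnderTy_eq σ A).symm)

theorem elem_piLam_re (σ : Γ' ⟶ Γ)
    (a : (localUniverses PC (F.obj I.ext)).Tm (Γ := Δ.reindex (F.map I.proj)) A) :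
    HEq (elem (piLam (T I.fib) (LocalTy.map_isPullback hF (I.sub σ.hom))
        (Δ := Δ.reindex (F.map σ.hom))
        (reUnderTm (D := changeOfBase PB PC F) σ (I := I) (Δ := Δ) a)))
      (Δ.reindexMap (F.map σ.hom) ≫
        elem (piLam (T I.fib) (LocalTy.map_isPullback hF I) a)) :=
  elem_piLam_heq (T I.fib) (LocalTy.map_isPullback hF I) (LocalTy.map_isPullback hF (I.sub σ.hom))
    (underMap_elt σ I Δ) (underMap_reindexMap σ I Δ) (reindexMap_classifier σ I Δ)
    (reUnderTy_eq σ A) (elem_reUnderTm σ a)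

theorem piFun_re (σ : Γ' ⟶ Γ)
    {f : (localUniverses PC (F.obj Γ.obj)).Tm (Γ := Δ)
      (piTy (T I.fib) (LocalTy.map_isPullback hF I) A)}
    {f₁ : (localUniverses PC (F.obj Γ'.obj)).Tm (Γ := Δ.reindex (F.map σ.hom))
      (piTy (T I.fib) (LocalTy.map_isPullback hF (I.sub σ.hom))
        (reUnderTy (D := changeOfBase PB PC F) σ (I := I) (Δ := Δ) A))}
    (hf : HEq (elem f₁) (Δ.reindexMap (F.map σ.hom) ≫ elem f)) :
    HEq (piFun (T I.fib) (LocalTy.map_isPullback hF (I.sub σ.hom)) f₁)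
      (underMap σ I Δ ≫ piFun (T I.fib) (LocalTy.map_isPullback hF I) f) :=
  piFun_heq (T I.fib) (LocalTy.map_isPullback hF I) (LocalTy.map_isPullback hF (I.sub σ.hom))
    (underMap_elt σ I Δ) (underMap_reindexMap σ I Δ) (reUnderTy_eq σ A) hf

/-- Generic application is natural along `underMap`, and `instMap_underMap` exchanges instantiation
with reindexing. -/
theorem elem_piApp_re (σ : Γ' ⟶ Γ)
    {f : (localUniverses PC (F.obj Γ.obj)).Tm (Γ := Δ)
      (piTy (T I.fib) (LocalTy.map_isPullback hF I) A)}
    {f₁ : (localUniverses PC (F.obj Γ'.obj)).Tm (Γ := Δ.reindex (F.map σ.hom))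
      (piTy (T I.fib) (LocalTy.map_isPullback hF (I.sub σ.hom))
        (reUnderTy (D := changeOfBase PB PC F) σ (I := I) (Δ := Δ) A))}
    (hf : HEq (elem f₁) (Δ.reindexMap (F.map σ.hom) ≫ elem f))
    (j : (localUniversesTop PB).Tm (Γ := Γ) I) :
    HEq (Δ.reindexMap (F.map σ.hom) ≫ elem (X := F.obj Γ.obj) (Δ := Δ)
        (A := instTy (D := changeOfBase PB PC F) j (Δ := Δ) A) (piApp T hF f j))
      (elem (X := F.obj Γ'.obj) (Δ := Δ.reindex (F.map σ.hom))
        (A := instTy (D := changeOfBase PB PC F) (j.sub σ) (Δ := Δ.reindex (F.map σ.hom))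
          (reUnderTy (D := changeOfBase PB PC F) σ (I := I) (Δ := Δ) A))
        (piApp (I := I.sub σ.hom) T hF f₁ (j.sub σ))) := by
  refine (comp_heq_comp _ (congrArg LocalTy.E (instTy_eq j Δ A)) (elem_piApp T hF f j)).trans ?_
  refine HEq.trans ?_ (elem_piApp (I := I.sub σ.hom) T hF f₁ (j.sub σ)).symm
  refine HEq.trans (heq_of_eq ?_)
    (comp_heq_comp _ (congrArg LocalTy.E (reUnderTy_eq σ A)) (piFun_re T hF σ hf)).symm
  exact (Category.assoc _ _ _).symm.trans ((congrArg (· ≫ piFun (T I.fib) _ f)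
    (instMap_underMap σ j Δ).symm).trans (Category.assoc _ _ _))

theorem piFun_sub {Δ' : LocalCtx PC (F.obj Γ.obj)} (τ : Δ' ⟶ Δ)
    {f : (localUniverses PC (F.obj Γ.obj)).Tm (Γ := Δ)
      (piTy (T I.fib) (LocalTy.map_isPullback hF I) A)}
    {f₁ : (localUniverses PC (F.obj Γ.obj)).Tm (Γ := Δ')
      (piTy (T I.fib) (LocalTy.map_isPullback hF I)
        (A.sub (LocalCtx.reindexHom (F.map I.proj) τ).hom))}
    (hf : HEq (elem f₁) (τ.hom ≫ elem f)) :
    piFun (T I.fib) (LocalTy.map_isPullback hF I) f₁ =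
      (LocalCtx.reindexHom (F.map I.proj) τ).hom ≫
        piFun (T I.fib) (LocalTy.map_isPullback hF I) f :=
  eq_of_heq (piFun_heq (T I.fib) (LocalTy.map_isPullback hF I) (LocalTy.map_isPullback hF I)
    (reindexHom_elt I τ) (LocalCtx.reindexHom_map _ τ) rfl hf)

theorem elem_piApp_sub {Δ' : LocalCtx PC (F.obj Γ.obj)} (τ : Δ' ⟶ Δ)
    {f : (localUniverses PC (F.obj Γ.obj)).Tm (Γ := Δ)
      (piTy (T I.fib) (LocalTy.map_isPullback hF I) A)}
    {f₁ : (localUniverses PC (F.obj Γ.obj)).Tm (Γ := Δ')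
      (piTy (T I.fib) (LocalTy.map_isPullback hF I)
        (A.sub (LocalCtx.reindexHom (F.map I.proj) τ).hom))}
    (hf : HEq (elem f₁) (τ.hom ≫ elem f)) (j : (localUniversesTop PB).Tm (Γ := Γ) I) :
    HEq (τ.hom ≫ elem (X := F.obj Γ.obj) (Δ := Δ)
        (A := instTy (D := changeOfBase PB PC F) j (Δ := Δ) A) (piApp T hF f j))
      (elem (X := F.obj Γ.obj) (Δ := Δ')
        (A := instTy (D := changeOfBase PB PC F) j (Δ := Δ')
          (A.sub (LocalCtx.reindexHom (F.map I.proj) τ).hom))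
        (piApp T hF f₁ j)) := by
  refine (comp_heq_comp _ (congrArg LocalTy.E (instTy_eq j Δ A)) (elem_piApp T hF f j)).trans ?_
  refine HEq.trans (heq_of_eq ?_) (elem_piApp T hF f₁ j).symm
  rw [piFun_sub T hF τ hf]
  exact (Category.assoc _ _ _).symm.trans ((congrArg (· ≫ piFun (T I.fib) _ f)
    (instMap_reindexHom j τ).symm).trans (Category.assoc _ _ _))

theorem piApp_piLam
    (a : (localUniverses PC (F.obj I.ext)).Tm (Γ := Δ.reindex (F.map I.proj)) A)
    (j : (localUniversesTop PB).Tm (Γ := Γ) I) :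
    piApp T hF (piLam (T I.fib) (LocalTy.map_isPullback hF I) a) j =
      instTm (D := changeOfBase PB PC F) j (Δ := Δ) a :=
  elem_injective (eq_of_heq ((elem_piApp T hF _ j).trans
    ((heq_of_eq (congrArg (instMap j Δ ≫ ·) (piFun_piLam (T I.fib) _ a))).trans
      (elem_instTm j a).symm)))

/-- Applying the weakened `f` to the variable restricts its generic application along `instMap` and
then `underMap`; the composite is the identity by `instMap_var`. With `piLam_eq` this is the η rule.
-/
theorem elem_piApp_var
    {f : (localUniverses PC (F.obj Γ.obj)).Tm (Γ := Δ)
      (piTy (T I.fib) (LocalTy.map_isPullback hF I) A)}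
    {f₁ : (localUniverses PC (F.obj I.ext)).Tm (Γ := Δ.reindex (F.map I.proj))
      (piTy (T I.fib) (LocalTy.map_isPullback hF (I.sub I.proj))
        (reUnderTy (D := changeOfBase PB PC F) (Γ := Γ) (LocalCtx.projHom I) (I := I) (Δ := Δ) A))}
    (hf : HEq (elem f₁) (Δ.reindexMap (F.map I.proj) ≫ elem f)) :
    HEq (elem (X := F.obj I.ext) (Δ := Δ.reindex (F.map I.proj))
        (A := instTy (D := changeOfBase PB PC F) (var (K := localUniversesTop PB) (Γ := Γ) I)
          (Δ := Δ.reindex (F.map I.proj))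
          (reUnderTy (D := changeOfBase PB PC F) (Γ := Γ) (LocalCtx.projHom I) (I := I) (Δ := Δ) A))
        (piApp (Γ := Γ.ext I) (I := I.sub I.proj) T hF f₁
          (var (K := localUniversesTop PB) (Γ := Γ) I)))
      (piFun (T I.fib) (LocalTy.map_isPullback hF I) f) := by
  refine (elem_piApp (Γ := Γ.ext I) (I := I.sub I.proj) T hF f₁ _).trans ?_
  refine (comp_heq_comp _ (congrArg LocalTy.E (reUnderTy_eq (LocalCtx.projHom I) A))
    (piFun_re T hF (LocalCtx.projHom I) hf)).trans (heq_of_eq ?_)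
  exact (Category.assoc _ _ _).symm.trans ((congrArg (· ≫ piFun (T I.fib) _ f)
    (instMap_var I Δ)).trans (Category.id_comp _))

/-- Dependent products in the change of base of the local universes construction. -/
noncomputable def dependentProducts : DependentProducts (changeOfBase PB PC F) where
  Pi {Γ : LocalCtx PB (⊤_ B)} (I : LocalTy PB Γ.obj) {Δ : LocalCtx PC (F.obj Γ.obj)}
    (A : LocalTy PC (Δ.reindex (F.map I.proj)).obj) :=
    piTy (T I.fib) (LocalTy.map_isPullback hF I) A
  lam {Γ : LocalCtx PB (⊤_ B)} {I : LocalTy PB Γ.obj} {Δ : LocalCtx PC (F.obj Γ.obj)}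
    {A : LocalTy PC (Δ.reindex (F.map I.proj)).obj} a :=
    piLam (T I.fib) (LocalTy.map_isPullback hF I) a
  app {Γ : LocalCtx PB (⊤_ B)} {I : LocalTy PB Γ.obj} {Δ : LocalCtx PC (F.obj Γ.obj)}
    {A : LocalTy PC (Δ.reindex (F.map I.proj)).obj} f j := piApp T hF f j
  Pi_re {Γ Γ' : LocalCtx PB (⊤_ B)} (σ : Γ' ⟶ Γ) (I : LocalTy PB Γ.obj)
    {Δ : LocalCtx PC (F.obj Γ.obj)} (A : LocalTy PC (Δ.reindex (F.map I.proj)).obj) :=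
    piTy_re T hF σ A
  lam_re {Γ Γ' : LocalCtx PB (⊤_ B)} (σ : Γ' ⟶ Γ) {I : LocalTy PB Γ.obj}
    {Δ : LocalCtx PC (F.obj Γ.obj)} {A : LocalTy PC (Δ.reindex (F.map I.proj)).obj} a :=
    castTy_eq (piTy_re T hF σ A)
      ((heq_of_eq (elem_reindex (F.map σ.hom) _)).trans (elem_piLam_re T hF σ a).symm)
  app_re {Γ Γ' : LocalCtx PB (⊤_ B)} (σ : Γ' ⟶ Γ) {I : LocalTy PB Γ.obj}
    {Δ : LocalCtx PC (F.obj Γ.obj)} {A : LocalTy PC (Δ.reindex (F.map I.proj)).obj} f j :=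
    castTy_eq _ ((heq_of_eq (elem_reindex (F.map σ.hom) _)).trans
      (elem_piApp_re T hF σ ((elem_castTy (piTy_re T hF σ A) _).trans
        (heq_of_eq (elem_reindex (F.map σ.hom) f))) j))
  Pi_sub {Γ : LocalCtx PB (⊤_ B)} (I : LocalTy PB Γ.obj) {Δ Δ' : LocalCtx PC (F.obj Γ.obj)}
    (τ : Δ' ⟶ Δ) (A : LocalTy PC (Δ.reindex (F.map I.proj)).obj) :=
    piTy_sub (T I.fib) (LocalTy.map_isPullback hF I) A (LocalTy.map_isPullback hF I)
      (reindexHom_elt I τ) (LocalCtx.reindexHom_map _ τ) (hom_classifier I τ)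
  lam_sub {Γ : LocalCtx PB (⊤_ B)} {I : LocalTy PB Γ.obj} {Δ Δ' : LocalCtx PC (F.obj Γ.obj)}
    (τ : Δ' ⟶ Δ) {A : LocalTy PC (Δ.reindex (F.map I.proj)).obj} a :=
    castTy_eq _ ((heq_of_eq (elem_sub _ τ)).trans
      (elem_piLam_heq (T I.fib) (LocalTy.map_isPullback hF I) (LocalTy.map_isPullback hF I)
        (reindexHom_elt I τ) (LocalCtx.reindexHom_map _ τ) (hom_classifier I τ) rfl
        (heq_of_eq (elem_sub a (LocalCtx.reindexHom (F.map I.proj) τ)))).symm)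
  app_sub {Γ : LocalCtx PB (⊤_ B)} {I : LocalTy PB Γ.obj} {Δ Δ' : LocalCtx PC (F.obj Γ.obj)}
    (τ : Δ' ⟶ Δ) {A : LocalTy PC (Δ.reindex (F.map I.proj)).obj} f j :=
    castTy_eq _ ((heq_of_eq (elem_sub _ τ)).trans
      (elem_piApp_sub T hF τ ((elem_castTy _ _).trans (heq_of_eq (elem_sub f τ))) j))
  beta {Γ : LocalCtx PB (⊤_ B)} {I : LocalTy PB Γ.obj} {Δ : LocalCtx PC (F.obj Γ.obj)}
    {A : LocalTy PC (Δ.reindex (F.map I.proj)).obj} a j := piApp_piLam T hF a j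
  eta {Γ : LocalCtx PB (⊤_ B)} {I : LocalTy PB Γ.obj} {Δ : LocalCtx PC (F.obj Γ.obj)}
    {A : LocalTy PC (Δ.reindex (F.map I.proj)).obj} f :=
    piLam_eq (T I.fib) (LocalTy.map_isPullback hF I) (eq_of_heq ((elem_castTy _ _).trans
      (elem_piApp_var T hF ((elem_castTy (piTy_re T hF (LocalCtx.projHom I) A) _).trans
        (heq_of_eq (elem_reindex (F.map I.proj) f))))))

end changeOfBase

end

theorem mainTheorem11 {B : Type u₁} [Category.{v₁} B] {C : Type u₂} [Category.{v₂} C]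
    -- `(B, PB)` and `(C, PC)` are categories with fibrations
    [HasTerminal B] (PB : MorphismProperty B) [PB.HasPullbacks] [PB.IsStableUnderBaseChange]
    [HasTerminal C] (PC : MorphismProperty C) [PC.HasPullbacks] [PC.IsStableUnderBaseChange]
    (F : B ⥤ C)
    -- the products `F(E) × V` exist
    (hprod : ∀ {E V : B} (p : E ⟶ V) {E' V' : C} (p' : E' ⟶ V'), PB p → PC p' →
      HasBinaryProduct (F.obj E) V')
    -- `F` preserves pullbacks along fibrations
    (hF : ∀ {X V E : B} (r : X ⟶ V) (p : E ⟶ V), PB p → PreservesLimit (cospan r p) F)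
    (hPi : ∀ {X Y : C} (g : X ⟶ Y), IsFFibration PB F g → HasFibrantPushforward PC g) :
    Nonempty (Indexed.DependentProducts (changeOfBase PB PC F)) := by
  have T {E V : B} {p : E ⟶ V} (hp : PB p) {E' V' : C} {p' : E' ⟶ V'} (hp' : PC p') :
      Nonempty (PiUniverse PC (F.map p) p') := by
    have := hprod p p' hp hp'
    exact nonempty_piUniverse PB PC F hPi p hp p' hp'
  -- The universe is chosen once for each pair of fibrations `p`, `p'`, independently of contexts
  -- and classifying maps; this makes stability strict.
  exact ⟨changeOfBase.dependentProducts (fun hp _ _ _ hp' => (T hp hp').some) hF⟩
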